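/- Throughout, graphs are finite and simple, and $\log$ is to base $2$. Let $h\ge 2$ be an integer and let $H$ be a graph on the vertex set $[h]=\{1,\dots,h\}$. For a graph $G$, let $i_H(G)$ be the number of vertex sets $X\subseteq V(G)$ such that the induced subgraph $G[X]$ is isomorphic to $H$, and let $i_H(n)$ be the maximum of $i_H(G)$ over all graphs $G$ with $n$ vertices. An equitable $(h,n)$-partition is a sequence $a_1,\dots,a_h$ of nonnegative integers with sum $n$, any two of which differ by at most $1$. Put $f(n,h)=\prod_{i=1}^h a_i$, where $a_1,\dots,a_h$ is an equitable $(h,n)$-partition; put $g(n,h)=0$ for $n<h$ and $g(n,h)=f(n,h)+\sum_{i=1}^h g(a_i,h)$ for $n\ge h$. A blowup of a graph $F$ is obtained by replacing each vertex $i$ of $F$ by a nonempty independent set $A_i$ (a part), where for distinct $i,j$ all pairs between $A_i$ and $A_j$ are edges if $ij\in E(F)$ and none is otherwise. It is balanced if the part sizes pairwise differ by at most $1$. For $n<h$ let $H^*(n)$ be the set of all graphs with $n$ vertices; for $n\ge h$ let $H^*(n)$ be the set of all graphs obtained from a balanced blowup of $H$ with $n$ vertices by replacing each part $A_i$ by an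 element of $H^*(|A_i|)$ (independently for each $i$). The elements of $H^*(n)$ are called nested balanced blowups of $H$. For $S\subseteq V(H)$, the agreement set of $S$ is the set of vertices outside $S$ that are adjacent to all vertices of $S$ or to none of them. The graph $H$ is strongly asymmetric, written $H\in\mathcal P_h$, if: 1. every vertex of $H$ has degree larger than $0.4h$ and smaller than $0.6h$; 2. the agreement set of any two distinct vertices has at most $0.55h$ elements, and the agreement set of any three distinct vertices has at most $0.3h$ elements; 3. there is $Q\subseteq[h]$ with $|Q|\le 3\log h$ that is not contained in the agreement set of any two distinct vertices outside $Q$; 4. for every $S\subseteq[h]$ with $|S|\le 0.7h$, every blowup $B$ of $H[S]$ with at least $0.8h$ and at most $h$ vertices and with each part of size at most $h/100$, and every $K\subseteq[h]$, one cannot obtain a graph isomorphic to $H[K]$ from $B$ by changing (adding or deleting as edges) at most $10^{-5}h^2$ pairs of vertices in distinct parts and arbitrarily many pairs inside parts; 5. for all $J,K\subseteq[h]$ with $|J|=|K|=\lceil 0.7h\rceil$ and every bijection $\pi:J\to K$ with at least $0.1h$ elements $v\in J$ such that $\pi(v)\ne v$, one cannot change (add or delete as edges) at most $10^{-5}h^2$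 pairs of vertices in $H[J]$ so that $\pi$ becomes an isomorphism from the obtained graph to $H[K]$. **Theorem.** For every $\varepsilon>0$ there is $h_0=h_0(\varepsilon)$ such that for all integers $h>h_0$, all integers $0\le n\le 2^{h^{1-\varepsilon}}$ and all $H\in\mathcal P_h$: (1) $i_H(n)=g(n,h)$, and a graph $G$ with $n$ vertices satisfies $i_H(G)=i_H(n)$ if and only if $G\in H^*(n)$; (2) if $n\ge h$ and $G$ is a graph with $n$ vertices and $i_H(G)\ge f(n,h)$, then $G$ is obtained from a balanced blowup of $H$ by adding some (possibly no) edges inside the blowup parts. -/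

import Mathlib

/-- The sizes of an equitable `(h,n)`-partition: for `i < h`, the `i`-th size is `⌊n/h⌋ + 1` if
`i < n mod h`, and `⌊n/h⌋` otherwise. -/
def equitablePart (n h i : ℕ) : ℕ := n / h + if i < n % h then 1 else 0

/-- `f(n,h)`: the product of the elements of an equitable `(h,n)`-partition. -/
def fEq (n h : ℕ) : ℕ := ∏ i ∈ Finset.range h, equitablePart n h i

theorem equitablePart_lt {n h i : ℕ} (hn : h ≤ n) (hh : 2 ≤ h) : equitablePart n h i < n := by
  unfold equitablePart
  have hmul : h * (n / h) + n % h = n := Nat.div_add_mod n h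
  have hge : 1 ≤ n / h := Nat.div_pos hn (by omega)
  have h2 : 2 * (n / h) ≤ h * (n / h) := Nat.mul_le_mul_right _ hh
  split_ifs with hi <;> omega

/-- `g(n,h)`: zero for `n < h`, and otherwise `f(n,h) + ∑ g(a_i,h)` over an equitable
`(h,n)`-partition `a_1, …, a_h` of `n`.  The recursion is only meaningful for `h ≥ 2`; the value is
set to zero for `h ≤ 1`. -/
def gEq (n h : ℕ) : ℕ :=
  if _hyp : h ≤ n ∧ 2 ≤ h then
    fEq n h + ∑ i ∈ Finset.range h, gEq (equitablePart n h i) h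
  else 0
termination_by n
decreasing_by exact equitablePart_lt _hyp.1 _hyp.2

namespace SimpleGraph

universe u v w

/-- `i_H(G)`: the number of induced copies of `H` in `G`, that is, of vertex sets `S` of `G` such
that `G[S]` is isomorphic to `H`. -/
noncomputable def inducedCopies {W : Type w} {V : Type v} (H : SimpleGraph W)
    (G : SimpleGraph V) : ℕ :=
  {S : Set V | Nonempty (H ≃g G.induce S)}.ncard

/-- `i_H(n)`: the maximum of `i_H(G)` over all graphs `G` with `n` vertices. -/
noncomputable def maxInducedCopies {W : Type w} (H : SimpleGraph W) (n : ℕ) : ℕ :=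
  ⨆ G : SimpleGraph (Fin n), inducedCopies H G

/-- The blowup of `H` on the vertex set `V` whose part corresponding to the vertex `i` of `H` is
`A_i = c⁻¹(i)`: each part is independent, and two distinct parts `A_i`, `A_j` are completely joined
if `ij` is an edge of `H` and completely non-adjacent otherwise. -/
def blowup {W : Type w} {V : Type v} (H : SimpleGraph W) (c : V → W) : SimpleGraph V :=
  H.comap c

/-- All parts are nonempty and their sizes pairwise differ by at most one. -/
def IsEquitable {W : Type w} {V : Type v} (c : V → W) : Prop :=
  Function.Surjective c ∧ ∀ i j, (c ⁻¹' {i}).ncard ≤ (c ⁻¹' {j}).ncard + 1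

/-- `G` is obtained from the blowup of `H` with parts `c⁻¹(i)` by adding edges (possibly none)
inside the parts. -/
def IsFilledBlowup {W : Type w} {V : Type v} (H : SimpleGraph W) (c : V → W)
    (G : SimpleGraph V) : Prop :=
  blowup H c ≤ G ∧ ∀ u v, G.Adj u v → ¬ (blowup H c).Adj u v → c u = c v

/-- `G` is obtained from a balanced blowup of `H` by adding edges (possibly none) inside the
blowup parts. -/
def IsFilledBalancedBlowup {W : Type w} {V : Type v} (H : SimpleGraph W)
    (G : SimpleGraph V) : Prop :=
  ∃ c : V → W, IsEquitable c ∧ IsFilledBlowup H c G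

/-- The graphs of the families `H*(n)`: all graphs with fewer than `h` vertices, and all graphs
obtained from a balanced blowup of `H` by replacing each (independent) part `A_i` with an element
of `H*(|A_i|)`. -/
inductive IsNestedBalancedBlowup {h : ℕ} (H : SimpleGraph (Fin h)) :
    {V : Type u} → SimpleGraph V → Prop
  | small {V : Type u} [Finite V] (G : SimpleGraph V) (hV : Nat.card V < h) :
      IsNestedBalancedBlowup H G
  | nest {V : Type u} [Finite V] (G : SimpleGraph V) (hV : h ≤ Nat.card V) (c : V → Fin h)
      (hc : IsEquitable c) (hG : IsFilledBlowup H c G)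
      (hparts : ∀ i, IsNestedBalancedBlowup H (G.induce (c ⁻¹' {i}))) :
      IsNestedBalancedBlowup H G

/-- The blowup `blowup H c` is blowup `m`-close to `H₂`: one can change at most `m` blowup pairs
(pairs of vertices in distinct parts), and arbitrarily many pairs inside the parts, so that the
result is isomorphic to `H₂`. -/
def IsBlowupClose {W : Type w} {V : Type v} {V₂ : Type u} (H : SimpleGraph W) (c : V → W) (m : ℝ)
    (H₂ : SimpleGraph V₂) : Prop :=
  ∃ G' : SimpleGraph V,
    ({e ∈ symmDiff (blowup H c).edgeSet G'.edgeSet | ¬ (e.map c).IsDiag}.ncard : ℝ) ≤ m ∧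
      Nonempty (G' ≃g H₂)

/-- The bijection `π` is `m`-close to an isomorphism between `H₁` and `H₂`: one can change at most
`m` edges of `H₁` so that `π` becomes an isomorphism between the obtained graph and `H₂`. -/
def IsCloseToIso {V₁ : Type v} {V₂ : Type w} (H₁ : SimpleGraph V₁) (H₂ : SimpleGraph V₂)
    (π : V₁ ≃ V₂) (m : ℝ) : Prop :=
  ∃ G' : SimpleGraph V₁,
    ((symmDiff H₁.edgeSet G'.edgeSet).ncard : ℝ) ≤ m ∧
      ∀ u v, G'.Adj u v ↔ H₂.Adj (π u) (π v)

/-- The agreement set `A(S)`: the vertices outside `S` that are adjacent to all vertices of `S` or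
to none of them. -/
def agreementSet {V : Type v} (H : SimpleGraph V) (S : Set V) : Set V :=
  {w | w ∉ S ∧ ((∀ s ∈ S, H.Adj w s) ∨ ∀ s ∈ S, ¬ H.Adj w s)}

/-- `Q` is not contained in the agreement set of any two vertices outside `Q`. -/
def IsDistinguishing {V : Type v} (H : SimpleGraph V) (Q : Set V) : Prop :=
  ∀ u v, u ∉ Q → v ∉ Q → u ≠ v → ¬ Q ⊆ agreementSet H {u, v}

/-- The family `𝒫_h` of strongly asymmetric graphs on `h` vertices. -/
structure IsStronglyAsymmetric {h : ℕ} (H : SimpleGraph (Fin h)) : Prop where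
  degree : ∀ v, 0.4 * (h : ℝ) < ((H.neighborSet v).ncard : ℝ) ∧
    ((H.neighborSet v).ncard : ℝ) < 0.6 * (h : ℝ)
  agreement_pair : ∀ S : Set (Fin h), S.ncard = 2 →
    ((agreementSet H S).ncard : ℝ) ≤ 0.55 * (h : ℝ)
  agreement_triple : ∀ S : Set (Fin h), S.ncard = 3 →
    ((agreementSet H S).ncard : ℝ) ≤ 0.3 * (h : ℝ)
  distinguishing : ∃ Q : Set (Fin h), IsDistinguishing H Q ∧
    (Q.ncard : ℝ) ≤ 3 * Real.logb 2 (h : ℝ)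
  blowup_far : ∀ S : Set (Fin h), (S.ncard : ℝ) ≤ 0.7 * (h : ℝ) →
    ∀ (b : ℕ) (c : Fin b → S), Function.Surjective c → 0.8 * (h : ℝ) ≤ (b : ℝ) → b ≤ h →
      (∀ i, ((c ⁻¹' {i}).ncard : ℝ) ≤ (h : ℝ) / 100) →
      ∀ K : Set (Fin h),
        ¬ IsBlowupClose (H.induce S) c ((h : ℝ) ^ 2 / 10 ^ 5) (H.induce K)
  iso_far : ∀ J K : Set (Fin h), J.ncard = ⌈0.7 * (h : ℝ)⌉₊ → K.ncard = ⌈0.7 * (h : ℝ)⌉₊ →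
    ∀ π : J ≃ K, 0.1 * (h : ℝ) ≤ ({v : J | (π v : Fin h) ≠ (v : Fin h)}.ncard : ℝ) →
      ¬ IsCloseToIso (H.induce J) (H.induce K) π ((h : ℝ) ^ 2 / 10 ^ 5)

end SimpleGraph

/-! The proof is a strong induction on `n` (`extremal`). Suppose that `G` has at least `f(n,h)`
copies of `H`. The inductive bound `g(n-1,h)` on the copies missing a vertex `v` forces every `v`
into at least `f/(2n)` copies, and from this `G` is shown to be exactly a filled balanced blowup
(`isFilledBalancedBlowup`). Since `H` has no nontrivial blowup structure, a copy in such a graph is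
either transversal to the parts, of which there are `f(n,h)`, or inside one part
(`inducedCopies_filledBlowup`). The recursion for `g` and the equality case then follow by induction
on the parts.

For the structure of `G`, fixing the images of a distinguishing set `Q` costs a factor `n ^ |Q|` and
makes the remaining copies transversals of a partition (`exists_transversal_classes`). Transversals
avoiding `γn` vertices are rarer than `f` by a factor of about `2 ^ (γh)`, which exceeds `n ^ (|Q| +
10)` because `|Q|` is logarithmic in `h` and `n ≤ 2 ^ (h ^ (1 - ε))`. So whatever a polynomial share
of the transversals avoids is small (`card_lt_of_many_transversals`), and outside a small set `D`
the graph is close to a blowup.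

Conversely, few `h`-sets meet a small set in many vertices, so nearly all copies contain few errors,
and strong asymmetry forces their vertices outside `D` into the roles of their classes
(`class_eq_of_few_wrong`). Giving each vertex a role that it plays often eliminates `D`
(`exists_classes`): misplaced copies now number at most `f/n^8`. An unbalanced pair of parts or a
single wrong adjacency would lose a share of order at least `1/n^2`, so neither occurs. -/

namespace SimpleGraph

/-! ### Rigidity of strongly asymmetric graphs. -/

/-- `φ` is an isomorphism from `H` onto an induced subgraph of `G`. -/
structure IsCopy {W V : Type*} (H : SimpleGraph W) (G : SimpleGraph V) (φ : W → V) : Prop where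
  injective : Function.Injective φ
  adj_iff : ∀ i j, G.Adj (φ i) (φ j) ↔ H.Adj i j

open Classical in
/-- The vertices in other classes of `w` whose adjacency to `v`, regarded as an element of the
class `i`, differs from the one prescribed by `H`. -/
noncomputable def wrongNeighbors {W V : Type*} [Fintype V] (H : SimpleGraph W) (G : SimpleGraph V)
    (w : V → W) (v : V) (i : W) : Finset V :=
  {u | w u ≠ i ∧ ¬ (G.Adj v u ↔ H.Adj i (w u))}

theorem mem_wrongNeighbors {W V : Type*} [Fintype V] {H : SimpleGraph W} {G : SimpleGraph V}
    {w : V → W} {v u : V} {i : W} :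
    u ∈ wrongNeighbors H G w v i ↔ w u ≠ i ∧ ¬ (G.Adj v u ↔ H.Adj i (w u)) := by
  simp [wrongNeighbors]

open Classical in
/-- Two graphs on the same vertex set differ in at most as many pairs as there are ordered pairs of
vertices on which they disagree. -/
theorem ncard_le_of_pairs {V : Type*} [Fintype V] (S : Set (Sym2 V)) (B : V → Finset V)
    (hS : ∀ u v, s(u, v) ∈ S → v ∈ B u) : S.ncard ≤ ∑ u, (B u).card := by
  have hsub : S ⊆ ((Finset.univ.sigma B).image fun p => s(p.1, p.2) : Finset (Sym2 V)) := by
    intro e he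
    induction e with
    | _ u v =>
      simp only [Finset.coe_image, Set.mem_image, Finset.mem_coe, Finset.mem_sigma,
        Finset.mem_univ, true_and]
      exact ⟨⟨u, v⟩, hS u v he, rfl⟩
  calc S.ncard ≤ ((Finset.univ.sigma B).image fun p => s(p.1, p.2) : Finset (Sym2 V)).card := by
        rw [← Set.ncard_coe_finset]
        exact Set.ncard_le_ncard hsub (Finset.finite_toSet _)
    _ ≤ _ := Finset.card_image_le
    _ = _ := Finset.card_sigma _ _

namespace IsStronglyAsymmetric

variable {h : ℕ} {H : SimpleGraph (Fin h)}

/-- Otherwise `H` itself would be close to a blowup of its subgraph induced on the range of `c`,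
against `blowup_far` with `K` the whole vertex set. -/
theorem lt_ncard_range (hH : H.IsStronglyAsymmetric) (c : Fin h → Fin h)
    (hfib : ∀ j, ((c ⁻¹' {j}).ncard : ℝ) ≤ h / 100)
    (hbad : ∑ i, ((wrongNeighbors H H c i (c i)).card : ℝ) ≤ (h : ℝ) ^ 2 / 10 ^ 5) :
    0.7 * (h : ℝ) < (Set.range c).ncard := by
  by_contra hlt
  refine hH.blowup_far (Set.range c) (not_lt.mp hlt) h (Set.rangeFactorization c)
    Set.rangeFactorization_surjective ?_ le_rfl ?_ Set.univ ?_
  · have : (0 : ℝ) ≤ h := Nat.cast_nonneg h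
    linarith
  · rintro ⟨j, hj⟩
    have : Set.rangeFactorization c ⁻¹' {⟨j, hj⟩} = c ⁻¹' {j} := by
      ext x
      simp [Set.rangeFactorization, Subtype.ext_iff]
    rw [this]
    exact hfib j
  · refine ⟨H, le_trans ?_ hbad, ⟨(SimpleGraph.induceUnivIso H).symm⟩⟩
    rw [← Nat.cast_sum, Nat.cast_le]
    apply ncard_le_of_pairs
    rintro u v ⟨huv, hd⟩
    have hd' : c u ≠ c v := fun e => hd (by simp [Set.rangeFactorization, e])
    rw [mem_wrongNeighbors]
    refine ⟨hd'.symm, ?_⟩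
    simp only [blowup, Set.mem_symmDiff, mem_edgeSet, comap_adj, Set.rangeFactorization] at huv
    tauto

/-- On a section `J` of `⌈0.7h⌉` elements of the range, `c` is a bijection close to an isomorphism,
so by `iso_far` it moves fewer than `0.1h` elements of `J`. -/
theorem le_ncard_fixed (hH : H.IsStronglyAsymmetric) (c : Fin h → Fin h)
    (hfib : ∀ j, ((c ⁻¹' {j}).ncard : ℝ) ≤ h / 100)
    (hbad : ∑ i, ((wrongNeighbors H H c i (c i)).card : ℝ) ≤ (h : ℝ) ^ 2 / 10 ^ 5) :
    0.6 * (h : ℝ) ≤ ({i | c i = i} : Set (Fin h)).ncard := by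
  have hr := hH.lt_ncard_range c hfib hbad
  obtain ⟨K, hKr, hK⟩ := Set.exists_subset_card_eq (s := Set.range c) (n := ⌈0.7 * (h : ℝ)⌉₊)
    (Nat.ceil_le.mpr hr.le)
  choose! g hg using fun (j : Fin h) (hj : j ∈ K) => hKr hj
  have hinj : Set.InjOn g K := fun x hx y hy e => by rw [← hg x hx, ← hg y hy, e]
  set J := g '' K with hJ
  have hJcard : J.ncard = ⌈0.7 * (h : ℝ)⌉₊ := by rw [hJ, hinj.ncard_image, hK]
  have hcJ : Set.BijOn c J K := by
    refine ⟨?_, ?_, ?_⟩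
    · rintro _ ⟨k, hk, rfl⟩
      rwa [hg k hk]
    · rintro _ ⟨k, hk, rfl⟩ _ ⟨l, hl, rfl⟩ e
      rw [hg k hk, hg l hl] at e
      rw [e]
    · intro k hk
      exact ⟨g k, ⟨k, hk, rfl⟩, hg k hk⟩
  set π : J ≃ K := hcJ.equiv c with hπ
  have hπv : ∀ v : J, (π v : Fin h) = c v := fun v => rfl
  have hclose : IsCloseToIso (H.induce J) (H.induce K) π ((h : ℝ) ^ 2 / 10 ^ 5) := by
    classical
    refine ⟨(H.induce K).comap π, le_trans ?_ hbad, fun u v => Iff.rfl⟩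
    have h1 := ncard_le_of_pairs (symmDiff (H.induce J).edgeSet ((H.induce K).comap π).edgeSet)
      (fun u => {v : J | (v : Fin h) ∈ wrongNeighbors H H c u (c u)}) (by
        intro u v huv
        simp only [Set.mem_symmDiff, mem_edgeSet, comap_adj, Function.Embedding.subtype_apply,
          hπv] at huv
        simp only [Finset.mem_filter, Finset.mem_univ, true_and, mem_wrongNeighbors]
        refine ⟨fun e => ?_, by tauto⟩
        have : v = u := Subtype.ext (hcJ.injOn v.2 u.2 e)
        subst this
        simp at huv)
    refine le_trans (Nat.cast_le.mpr h1) ?_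
    push_cast
    calc ∑ u : J, ((Finset.univ.filter
          fun v : J => (v : Fin h) ∈ wrongNeighbors H H c u (c u)).card : ℝ)
        ≤ ∑ u : J, ((wrongNeighbors H H c (u : Fin h) (c u)).card : ℝ) := by
          gcongr with u
          refine Finset.card_le_card_of_injOn (fun v => (v : Fin h)) ?_
            Subtype.val_injective.injOn
          intro v hv
          simpa using hv
      _ = ∑ u ∈ J.toFinset, ((wrongNeighbors H H c u (c u)).card : ℝ) := by
          rw [← Finset.sum_coe_sort J.toFinset]
          exact Fintype.sum_equiv (Equiv.subtypeEquivRight fun _ => Set.mem_toFinset.symm) _ _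
            (fun _ => rfl)
      _ ≤ _ := Finset.sum_le_sum_of_subset_of_nonneg (Finset.subset_univ _)
          (fun _ _ _ => Nat.cast_nonneg _)
  have hfew : ¬ 0.1 * (h : ℝ) ≤ ({v : J | (π v : Fin h) ≠ (v : Fin h)}.ncard : ℝ) :=
    fun hc => hH.iso_far J K hJcard hK π hc hclose
  have hsub : J ⊆ {i | c i = i} ∪
      Subtype.val '' {v : J | (π v : Fin h) ≠ (v : Fin h)} := by
    intro j hj
    by_cases e : c j = j
    · exact Or.inl e
    · exact Or.inr ⟨⟨j, hj⟩, e, rfl⟩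
  have h2 := (Set.ncard_le_ncard hsub (Set.toFinite _)).trans (Set.ncard_union_le _ _)
  rw [Set.ncard_image_of_injective _ Subtype.val_injective, hJcard] at h2
  have h3 : 0.7 * (h : ℝ) ≤ ⌈0.7 * (h : ℝ)⌉₊ := Nat.le_ceil _
  have h4 : (⌈0.7 * (h : ℝ)⌉₊ : ℝ) ≤ ({i | c i = i} : Set (Fin h)).ncard +
      {v : J | (π v : Fin h) ≠ (v : Fin h)}.ncard := by exact_mod_cast h2
  linarith

/-- A fixed point `k ≠ c i` of `c` is a wrong neighbor of `i` unless `i` and `c i` agree on it.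
There are at least `0.6h` fixed points and at most `0.55h` agreements; the lost `1` is absorbed by
`0.01h`. -/
theorem le_card_wrongNeighbors (hH : H.IsStronglyAsymmetric) (hh : 100 ≤ h) (c : Fin h → Fin h)
    (hfib : ∀ j, ((c ⁻¹' {j}).ncard : ℝ) ≤ h / 100)
    (hbad : ∑ i, ((wrongNeighbors H H c i (c i)).card : ℝ) ≤ (h : ℝ) ^ 2 / 10 ^ 5)
    {i : Fin h} (hi : c i ≠ i) :
    0.04 * (h : ℝ) ≤ (wrongNeighbors H H c i (c i)).card := by
  have hfix := hH.le_ncard_fixed c hfib hbad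
  have hag := hH.agreement_pair {i, c i} (Set.ncard_pair hi.symm)
  have hsub : ({k | c k = k} : Set (Fin h)) ⊆ {c i} ∪ (agreementSet H {i, c i} ∪
      (wrongNeighbors H H c i (c i) : Set (Fin h))) := by
    intro k hk
    by_cases e : k = c i
    · exact Or.inl e
    right
    have hki : k ≠ i := fun e' => hi (by rw [← e']; exact hk)
    have hk' : c k = k := hk
    by_cases e2 : H.Adj i k ↔ H.Adj (c i) k
    · left
      simp only [agreementSet, Set.mem_ofPred_eq, Set.mem_insert_iff, Set.mem_singleton_iff,
        forall_eq_or_imp, forall_eq]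
      refine ⟨by tauto, ?_⟩
      rw [H.adj_comm k i, H.adj_comm k (c i)]
      tauto
    · right
      rw [Finset.mem_coe, mem_wrongNeighbors, hk']
      exact ⟨e, e2⟩
  have h2 := (Set.ncard_le_ncard hsub (Set.toFinite _)).trans ((Set.ncard_union_le _ _).trans
    (Nat.add_le_add_left (Set.ncard_union_le _ _) _))
  rw [Set.ncard_singleton, Set.ncard_coe_finset] at h2
  have h3 : ((({i | c i = i} : Set (Fin h)).ncard : ℕ) : ℝ) ≤ 1 + ((agreementSet H {i, c i}).ncard +
      (wrongNeighbors H H c i (c i)).card) := by exact_mod_cast h2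
  have : (100 : ℝ) ≤ h := by exact_mod_cast hh
  linarith

theorem eq_id_of_wrongNeighbors_eq_empty (hH : H.IsStronglyAsymmetric) (hh : 100 ≤ h)
    (c : Fin h → Fin h) (hfib : ∀ j, ((c ⁻¹' {j}).ncard : ℝ) ≤ h / 100)
    (hbad : ∀ i, wrongNeighbors H H c i (c i) = ∅) (i : Fin h) : c i = i := by
  by_contra hi
  have := hH.le_card_wrongNeighbors hh c hfib (by simp [hbad]; positivity) hi
  rw [hbad i] at this
  have h1 : (100 : ℝ) ≤ h := by exact_mod_cast hh
  rw [Finset.card_empty, Nat.cast_zero] at this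
  linarith

/-- Two embeddings with the same image differ by an automorphism of `H`, which must be trivial.
Hence counting vertex sets is the same as counting embeddings. -/
theorem eq_of_range_eq (hH : H.IsStronglyAsymmetric) (hh : 100 ≤ h) {V : Type*}
    {G : SimpleGraph V} {φ ψ : Fin h → V} (hφ : IsCopy H G φ) (hψ : IsCopy H G ψ)
    (hr : Set.range φ = Set.range ψ) : φ = ψ := by
  have hex : ∀ i, ∃ j, ψ j = φ i := fun i => by
    have : φ i ∈ Set.range ψ := hr ▸ Set.mem_range_self i
    exact this
  choose c hc using hex
  have hcinj : Function.Injective c := fun i j e => hφ.injective (by rw [← hc, ← hc, e])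
  funext i
  rw [← hc i, hH.eq_id_of_wrongNeighbors_eq_empty hh c ?_ ?_ i]
  · intro j
    have h1 : (c ⁻¹' {j}).ncard ≤ 1 := by
      rw [Set.ncard_le_one (Set.toFinite _)]
      intro x hx y hy
      exact hcinj (hx.trans hy.symm)
    have h2 : ((c ⁻¹' {j}).ncard : ℝ) ≤ 1 := by exact_mod_cast h1
    have : (100 : ℝ) ≤ h := by exact_mod_cast hh
    linarith
  · intro i
    ext k
    rw [mem_wrongNeighbors, ← hψ.adj_iff (c i), hc, hc, hφ.adj_iff]
    simp

open Classical in
theorem inducedCopies_eq (hH : H.IsStronglyAsymmetric) (hh : 100 ≤ h) {V : Type*} [Fintype V]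
    (G : SimpleGraph V) :
    H.inducedCopies G = ({φ : Fin h → V | IsCopy H G φ} : Finset (Fin h → V)).card := by
  have : {S : Set V | Nonempty (H ≃g G.induce S)} =
      Set.range '' (({φ : Fin h → V | IsCopy H G φ} : Finset (Fin h → V)) : Set (Fin h → V)) := by
    ext S
    simp only [Set.mem_ofPred_eq, Finset.coe_filter, Finset.mem_univ, true_and, Set.mem_image]
    constructor
    · rintro ⟨e⟩
      refine ⟨fun i => (e i : V), ⟨Subtype.val_injective.comp e.injective,
        fun i j => e.map_adj_iff⟩, ?_⟩
      ext v
      constructor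
      · rintro ⟨i, rfl⟩
        exact (e i).2
      · intro hv
        exact ⟨e.symm ⟨v, hv⟩, by simp⟩
    · rintro ⟨φ, hφ, rfl⟩
      exact ⟨⟨Equiv.ofInjective φ hφ.injective, hφ.adj_iff _ _⟩⟩
  rw [inducedCopies, this, Set.InjOn.ncard_image, Set.ncard_coe_finset]
  intro φ hφ ψ hψ e
  exact hH.eq_of_range_eq hh (by simpa using hφ) (by simpa using hψ) e

end IsStronglyAsymmetric

end SimpleGraph


/-! ### Products over equitable partitions and their stability. -/

section EquitableProduct

theorem sum_equitablePart (n h : ℕ) (hh : 0 < h) :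
    ∑ i ∈ Finset.range h, equitablePart n h i = n := by
  unfold equitablePart
  rw [Finset.sum_add_distrib, Finset.sum_const, Finset.card_range, smul_eq_mul,
    ← Finset.card_filter]
  have : (Finset.range h).filter (· < n % h) = Finset.range (n % h) := by
    ext i
    have := Nat.mod_lt n hh
    simp only [Finset.mem_filter, Finset.mem_range]
    omega
  rw [this, Finset.card_range]
  exact Nat.div_add_mod n h

/-- Concavity of the logarithm at integers: the geometric sequence through the points `a` and
`a + 1` of the identity lies above the identity at all integers. -/
theorem mul_pow_le_mul_pow {a : ℕ} (ha : 0 < a) (x : ℕ) :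
    (x : ℝ) * (1 + 1 / (a : ℝ)) ^ a ≤ a * (1 + 1 / (a : ℝ)) ^ x := by
  have ha' : (0 : ℝ) < a := by exact_mod_cast ha
  set l : ℝ := 1 + 1 / (a : ℝ) with hl
  have hal : a * l = a + 1 := by rw [hl]; field_simp
  have hl0 : 0 < l := by rw [hl]; positivity
  rcases le_total a x with hx | hx
  · induction x, hx using Nat.le_induction with
    | base => exact le_rfl
    | succ x hx ih =>
      have hx' : (a : ℝ) ≤ x := by exact_mod_cast hx
      have h1 : ((x : ℝ) + 1) ≤ x * l := by
        rw [hl, mul_add, mul_one]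
        gcongr
        rw [mul_one_div, le_div_iff₀ ha']
        linarith
      have h2 : 0 < l ^ a := by positivity
      calc ((x + 1 : ℕ) : ℝ) * l ^ a ≤ (x * l) * l ^ a := by push_cast; gcongr
        _ = l * (x * l ^ a) := by ring
        _ ≤ l * (a * l ^ x) := by gcongr
        _ = _ := by ring
  · induction hx using Nat.decreasingInduction with
    | self => exact le_rfl
    | of_succ x hx ih =>
      have hx' : (x : ℝ) + 1 ≤ a := by exact_mod_cast hx
      have h1 : (x : ℝ) * l ≤ x + 1 := by
        rw [hl, mul_add, mul_one]
        gcongr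
        rw [mul_one_div, div_le_one ha']
        linarith
      push_cast at ih
      have hx0 : (0 : ℝ) < x + 1 := by positivity
      rw [← mul_le_mul_iff_right₀ hx0]
      calc ((x : ℝ) + 1) * (x * l ^ a) = x * ((x + 1) * l ^ a) := by ring
        _ ≤ x * (a * l ^ (x + 1)) := by gcongr
        _ = (x * l) * (a * l ^ x) := by ring
        _ ≤ (x + 1) * (a * l ^ x) := by gcongr

theorem eq_mul_pow_of_eq_or {a : ℕ} (ha : 0 < a) {x : ℕ} (hx : x = a ∨ x = a + 1) :
    (x : ℝ) * (1 + 1 / (a : ℝ)) ^ a = a * (1 + 1 / (a : ℝ)) ^ x := by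
  have ha' : (a : ℝ) ≠ 0 := by positivity
  rcases hx with rfl | rfl
  · rfl
  · rw [pow_succ]
    push_cast
    field_simp

theorem prod_mul_pow_le {ι : Type*} {a : ℕ} (ha : 0 < a) (F : Finset ι) (x : ι → ℕ) :
    (∏ k ∈ F, (x k : ℝ)) * (1 + 1 / (a : ℝ)) ^ (a * F.card) ≤
      a ^ F.card * (1 + 1 / (a : ℝ)) ^ (∑ k ∈ F, x k) := by
  rw [pow_mul, ← Finset.prod_const, ← Finset.prod_const, ← Finset.prod_pow_eq_pow_sum,
    ← Finset.prod_mul_distrib, ← Finset.prod_mul_distrib]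
  exact Finset.prod_le_prod (fun _ _ => by positivity) fun k _ => mul_pow_le_mul_pow ha (x k)

theorem prod_mul_pow_eq {ι : Type*} {a : ℕ} (ha : 0 < a) (F : Finset ι) (x : ι → ℕ)
    (hx : ∀ k ∈ F, x k = a ∨ x k = a + 1) :
    (∏ k ∈ F, (x k : ℝ)) * (1 + 1 / (a : ℝ)) ^ (a * F.card) =
      a ^ F.card * (1 + 1 / (a : ℝ)) ^ (∑ k ∈ F, x k) := by
  rw [pow_mul, ← Finset.prod_const, ← Finset.prod_const, ← Finset.prod_pow_eq_pow_sum,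
    ← Finset.prod_mul_distrib, ← Finset.prod_mul_distrib]
  exact Finset.prod_congr rfl fun k hk => eq_mul_pow_of_eq_or ha (hx k hk)

theorem equitablePart_eq_or (n h i : ℕ) :
    equitablePart n h i = n / h ∨ equitablePart n h i = n / h + 1 := by
  unfold equitablePart
  split_ifs <;> simp

variable {n h : ℕ}

theorem fEq_mul_pow (hh : 0 < h) (hn : h ≤ n) :
    (fEq n h : ℝ) * (1 + 1 / ((n / h : ℕ) : ℝ)) ^ (n / h * h) =
      ((n / h : ℕ) : ℝ) ^ h * (1 + 1 / ((n / h : ℕ) : ℝ)) ^ n := by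
  have := prod_mul_pow_eq (Nat.div_pos hn hh) (Finset.range h) (equitablePart n h)
    fun k _ => equitablePart_eq_or n h k
  rwa [sum_equitablePart n h hh, Finset.card_range, ← Nat.cast_prod] at this

theorem pow_div_le_fEq (n h : ℕ) : (n / h) ^ h ≤ fEq n h := by
  unfold fEq
  calc (n / h) ^ h = ∏ _i ∈ Finset.range h, n / h := by simp
    _ ≤ _ := Finset.prod_le_prod' fun i _ => by unfold equitablePart; omega

theorem fEq_pos (hh : 0 < h) (hn : h ≤ n) : 0 < fEq n h :=
  lt_of_lt_of_le (pow_pos (Nat.div_pos hn hh) _) (pow_div_le_fEq n h)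

theorem two_le_one_add_pow {a : ℕ} (ha : 0 < a) : (2 : ℝ) ≤ (1 + 1 / (a : ℝ)) ^ a := by
  have ha' : (0 : ℝ) < a := by exact_mod_cast ha
  have := one_add_mul_le_pow (a := 1 / (a : ℝ)) (by
    have : 0 < 1 / (a : ℝ) := by positivity
    linarith) a
  rw [mul_one_div_cancel ha'.ne'] at this
  linarith

theorem one_add_pow_le_three {a : ℕ} (ha : 0 < a) : (1 + 1 / (a : ℝ)) ^ a ≤ 3 := by
  have ha' : (0 : ℝ) < a := by exact_mod_cast ha
  calc (1 + 1 / (a : ℝ)) ^ a ≤ (Real.exp (1 / a)) ^ a := by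
        gcongr
        rw [add_comm]
        exact Real.add_one_le_exp _
    _ = Real.exp 1 := by rw [← Real.exp_nat_mul, mul_one_div_cancel ha'.ne']
    _ ≤ 3 := by have := Real.exp_one_lt_d9; linarith

theorem two_rpow_le_pow {a s : ℕ} (ha : 0 < a) {δ : ℝ} (hδ : 0 ≤ δ)
    (hs : δ * (a * h : ℕ) ≤ s) :
    (2 : ℝ) ^ (δ * h) ≤ (1 + 1 / (a : ℝ)) ^ s := by
  have ha' : (0 : ℝ) < a := by exact_mod_cast ha
  have hl : 1 ≤ 1 + 1 / (a : ℝ) := by have : 0 < 1 / (a : ℝ) := by positivity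
                                      linarith
  calc (2 : ℝ) ^ (δ * h) ≤ ((1 + 1 / (a : ℝ)) ^ a) ^ (δ * h) :=
        Real.rpow_le_rpow (by norm_num) (two_le_one_add_pow ha) (by positivity)
    _ = (1 + 1 / (a : ℝ)) ^ (a * (δ * h)) := by
        rw [← Real.rpow_natCast, ← Real.rpow_mul (by positivity)]
    _ ≤ (1 + 1 / (a : ℝ)) ^ (s : ℝ) := by
        apply Real.rpow_le_rpow_of_exponent_le hl
        push_cast at hs
        linarith
    _ = _ := Real.rpow_natCast _ _

/-- A product of natural numbers over a subset `F` of the `h` indices, whose sum falls short of `n`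
by a proportion of at least `δ`. -/
theorem prod_mul_two_rpow_le (hh : 0 < h) (hn : h ≤ n) (F : Finset (Fin h)) (x : Fin h → ℕ)
    {s : ℕ} (hs : ∑ k ∈ F, x k + s ≤ n) {δ : ℝ} (hδ : 0 ≤ δ) (hδs : δ * n ≤ s) :
    (∏ k ∈ F, (x k : ℝ)) * 2 ^ (δ * h) ≤ fEq n h * 3 ^ (h - F.card) := by
  have ha := Nat.div_pos hn hh
  have hf := fEq_mul_pow hh hn
  have hP := prod_mul_pow_le ha F x
  set a := n / h
  set l : ℝ := 1 + 1 / (a : ℝ) with hl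
  have ha' : (0 : ℝ) < a := by exact_mod_cast ha
  have hl1 : 1 ≤ l := by rw [hl]; have : 0 < 1 / (a : ℝ) := by positivity
                         linarith
  have hahn : a * h ≤ n := Nat.div_mul_le_self n h
  -- The missing sum `s` costs a factor `l ^ s`, and `l ^ a ≥ 2` with `s ≥ δ * n ≥ δ * a * h`
  -- converts it into `2 ^ (δ * h)`.
  have h2 : (2 : ℝ) ^ (δ * h) ≤ l ^ s := by
    refine two_rpow_le_pow ha hδ (le_trans ?_ hδs)
    gcongr
  have hFc : F.card ≤ h := by simpa using Finset.card_le_univ F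
  obtain ⟨e, he⟩ := Nat.exists_eq_add_of_le hFc
  have he' : h - F.card = e := by omega
  have hpa : (a : ℝ) ^ h = a ^ F.card * a ^ e := by
    rw [← pow_add]; exact congrArg (fun t => (a : ℝ) ^ t) he
  have hpl : l ^ (a * h) = l ^ (a * e + a * F.card) := by
    rw [← mul_add, add_comm e]; exact congrArg (fun t => l ^ (a * t)) he
  rw [he']
  set P := ∏ k ∈ F, (x k : ℝ) with hPdef
  have hP0 : 0 ≤ P := Finset.prod_nonneg fun _ _ => Nat.cast_nonneg _
  have hae : (1 : ℝ) ≤ a ^ e := one_le_pow₀ (by exact_mod_cast ha)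
  have hpos : 0 < l ^ (a * F.card) := by positivity
  rw [← mul_le_mul_iff_left₀ hpos]
  calc P * 2 ^ (δ * h) * l ^ (a * F.card) ≤ P * l ^ s * l ^ (a * F.card) := by gcongr
    _ = (P * l ^ (a * F.card)) * l ^ s := by ring
    _ ≤ (a ^ F.card * l ^ (∑ k ∈ F, x k)) * l ^ s := by gcongr
    _ = a ^ F.card * l ^ (∑ k ∈ F, x k + s) := by rw [pow_add]; ring
    _ ≤ a ^ F.card * l ^ n := by gcongr
    _ ≤ a ^ F.card * l ^ n * a ^ e := le_mul_of_one_le_right (by positivity) hae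
    _ = a ^ h * l ^ n := by rw [hpa]; ring
    _ = fEq n h * l ^ (a * h) := hf.symm
    _ = fEq n h * (l ^ a) ^ e * l ^ (a * F.card) := by
        rw [← pow_mul, mul_assoc, ← pow_add, hpl]
    -- Each of the `e` omitted indices costs at most `l ^ a ≤ 3`.
    _ ≤ fEq n h * 3 ^ e * l ^ (a * F.card) := by
        gcongr
        exact one_add_pow_le_three ha

theorem prod_le_fEq (hh : 0 < h) (hn : h ≤ n) (x : Fin h → ℕ) (hx : ∑ k, x k ≤ n) :
    ∏ k, x k ≤ fEq n h := by
  have := prod_mul_two_rpow_le hh hn Finset.univ x (s := 0) hx le_rfl (by simp)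
  simp only [zero_mul, Real.rpow_zero, mul_one, Finset.card_univ, Fintype.card_fin,
    Nat.sub_self, pow_zero] at this
  exact_mod_cast this

-- Moving one unit from the larger part to the smaller raises the product of the two sizes by at
-- least `1`, while that product is at most `n ^ 2`; the new product is still at most `fEq n h`.
open Finset in
theorem prod_mul_le_of_not_balanced (hh : 0 < h) (hn : h ≤ n) (x : Fin h → ℕ)
    (hx : ∑ k, x k = n) {i j : Fin h} (hij : x j + 1 < x i) :
    (∏ k, x k) * (n ^ 2 + 1) ≤ fEq n h * n ^ 2 := by
  have hne : i ≠ j := by rintro rfl; omega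
  have hmem : j ∈ univ.erase i := by simp [hne.symm]
  set P := ∏ k ∈ (univ.erase i).erase j, x k with hP
  have hprod : ∀ y : Fin h → ℕ, ∏ k, y k = y i * (y j * ∏ k ∈ (univ.erase i).erase j, y k) := by
    intro y
    rw [mul_prod_erase _ _ hmem, mul_prod_erase _ _ (mem_univ i)]
  have hsum : ∀ y : Fin h → ℕ, ∑ k, y k = y i + (y j + ∑ k ∈ (univ.erase i).erase j, y k) := by
    intro y
    rw [add_sum_erase _ _ hmem, add_sum_erase _ _ (mem_univ i)]
  set y : Fin h → ℕ := fun k => if k = i then x i - 1 else if k = j then x j + 1 else x k with hy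
  have hyi : y i = x i - 1 := by simp [hy]
  have hyj : y j = x j + 1 := by simp [hy, hne.symm]
  have hyk : ∀ k ∈ (univ.erase i).erase j, y k = x k := by
    intro k hk
    simp only [mem_erase, mem_univ, and_true] at hk
    simp [hy, hk.1, hk.2]
  have hxs := hsum x
  have hys := hsum y
  have hyx : ∑ k ∈ (univ.erase i).erase j, y k = ∑ k ∈ (univ.erase i).erase j, x k :=
    sum_congr rfl hyk
  rw [hyi, hyj, hyx] at hys
  have hle := prod_le_fEq hh hn y (by omega)
  have hyp : ∏ k ∈ (univ.erase i).erase j, y k = P := prod_congr rfl hyk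
  rw [hprod y, hyi, hyj, hyp] at hle
  rw [hprod x, ← hP]
  obtain ⟨t, ht⟩ := Nat.exists_eq_add_of_lt hij
  rw [ht] at hle hxs ⊢
  have hsub : x j + 1 + t + 1 - 1 = x j + 1 + t := by omega
  rw [hsub] at hle
  set b := x j
  have h1 : (b + 1 + t + 1) * b + 1 ≤ (b + 1 + t) * (b + 1) := by nlinarith
  have h2 : (b + 1 + t + 1) * b ≤ n ^ 2 := by
    rw [pow_two]; exact Nat.mul_le_mul (by omega) (by omega)
  calc (b + 1 + t + 1) * (b * P) * (n ^ 2 + 1)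
      = ((b + 1 + t + 1) * b) * P * n ^ 2 + ((b + 1 + t + 1) * b) * P := by ring
    _ ≤ ((b + 1 + t + 1) * b) * P * n ^ 2 + n ^ 2 * P := by gcongr
    _ = ((b + 1 + t + 1) * b + 1) * P * n ^ 2 := by ring
    _ ≤ ((b + 1 + t) * (b + 1)) * P * n ^ 2 := by gcongr
    _ = ((b + 1 + t) * ((b + 1) * P)) * n ^ 2 := by ring
    _ ≤ _ := by gcongr

theorem eq_div_or_of_balanced (hh : 0 < h) (x : Fin h → ℕ) (hx : ∑ k, x k = n)
    (hb : ∀ i j, x i ≤ x j + 1) (i : Fin h) : x i = n / h ∨ x i = n / h + 1 := by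
  have h1 := Nat.div_mul_le_self n h
  have h2 := Nat.lt_div_mul_add hh (a := n)
  set a := n / h
  rcases lt_trichotomy (x i) a with hlt | heq | hgt
  · exfalso
    have : ∑ k, x k < ∑ _k : Fin h, a := Finset.sum_lt_sum
      (fun j _ => by have := hb j i; omega) ⟨i, Finset.mem_univ _, hlt⟩
    simp only [Finset.sum_const, Finset.card_univ, Fintype.card_fin, smul_eq_mul] at this
    rw [mul_comm] at this
    omega
  · exact Or.inl heq
  · right
    by_contra hne
    have : ∑ _k : Fin h, (a + 1) < ∑ k, x k := Finset.sum_lt_sum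
      (fun j _ => by have := hb i j; omega) ⟨i, Finset.mem_univ _, by omega⟩
    simp only [Finset.sum_const, Finset.card_univ, Fintype.card_fin, smul_eq_mul] at this
    rw [mul_comm, add_mul] at this
    omega

theorem prod_eq_fEq_of_balanced (hh : 0 < h) (hn : h ≤ n) (x : Fin h → ℕ) (hx : ∑ k, x k = n)
    (hb : ∀ i j, x i ≤ x j + 1) : ∏ k, x k = fEq n h := by
  have ha := Nat.div_pos hn hh
  have h1 := prod_mul_pow_eq ha Finset.univ x fun k _ => eq_div_or_of_balanced hh x hx hb k
  rw [hx, Finset.card_univ, Fintype.card_fin, ← fEq_mul_pow hh hn] at h1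
  have hpos : (1 + 1 / ((n / h : ℕ) : ℝ)) ^ (n / h * h) ≠ 0 := by positivity
  have := mul_right_cancel₀ hpos h1
  exact_mod_cast this

theorem sum_eq_of_balanced (hh : 0 < h) (x : Fin h → ℕ) (hx : ∑ k, x k = n)
    (hb : ∀ i j, x i ≤ x j + 1) (F : ℕ → ℕ) :
    ∑ k, F (x k) = ∑ i ∈ Finset.range h, F (equitablePart n h i) := by
  -- On two consecutive integers `F` coincides with an affine function, so its sum over balanced
  -- sizes depends only on their number and their total.
  have key : ∀ y : ℕ, y = n / h ∨ y = n / h + 1 →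
      (F y : ℤ) = F (n / h) + ((y : ℤ) - (n / h : ℕ)) * (F (n / h + 1) - F (n / h)) := by
    rintro y (rfl | rfl)
    · ring
    · push_cast; ring
  have h1 : (∑ k, F (x k) : ℤ) =
      h * F (n / h) + ((n : ℤ) - h * (n / h : ℕ)) * (F (n / h + 1) - F (n / h)) := by
    rw [Finset.sum_congr rfl fun k _ => key _ (eq_div_or_of_balanced hh x hx hb k),
      Finset.sum_add_distrib, ← Finset.sum_mul, Finset.sum_sub_distrib, ← hx]
    simp
  have hs : ∑ i ∈ Finset.range h, (equitablePart n h i : ℤ) = n := by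
    exact_mod_cast sum_equitablePart n h hh
  have h2 : (∑ i ∈ Finset.range h, F (equitablePart n h i) : ℤ) =
      h * F (n / h) + ((n : ℤ) - h * (n / h : ℕ)) * (F (n / h + 1) - F (n / h)) := by
    rw [Finset.sum_congr rfl fun k _ => key _ (equitablePart_eq_or n h k),
      Finset.sum_add_distrib, ← Finset.sum_mul, Finset.sum_sub_distrib, hs]
    simp
  exact_mod_cast h1.trans h2.symm

theorem sum_fin_equitablePart (hh : 0 < h) : ∑ i : Fin h, equitablePart n h i = n := by
  rw [← Finset.sum_range, sum_equitablePart n h hh]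

theorem fEq_mul_succ_le (hh : 0 < h) (hn : h ≤ n) : fEq n h * (n + 1) ≤ fEq (n + 1) h * n := by
  set i : Fin h := ⟨0, hh⟩
  set x : Fin h → ℕ := fun i => equitablePart n h i
  have hsum : ∑ k, x k = n := sum_fin_equitablePart hh
  have hprod : fEq n h = ∏ k, x k := Finset.prod_range _
  have h1 := prod_le_fEq hh (hn.trans n.le_succ) (Function.update x i (x i + 1)) (by
    rw [Finset.sum_update_of_mem (Finset.mem_univ i), ← hsum,
      ← Finset.add_sum_erase _ _ (Finset.mem_univ i), Finset.sdiff_singleton_eq_erase]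
    omega)
  rw [Finset.prod_update_of_mem (Finset.mem_univ i), Finset.sdiff_singleton_eq_erase] at h1
  rw [← Finset.mul_prod_erase _ _ (Finset.mem_univ i)] at hprod
  set P := ∏ k ∈ Finset.univ.erase i, x k
  have hxi : x i ≤ n := by
    rw [← hsum]
    exact Finset.single_le_sum (f := x) (fun _ _ => Nat.zero_le _) (Finset.mem_univ i)
  rw [hprod]
  calc x i * P * (n + 1) = x i * P * n + x i * P := by ring
    _ ≤ x i * P * n + n * P := by gcongr
    _ = (x i + 1) * P * n := by ring
    _ ≤ _ := by gcongr

/-- The inequality of arithmetic and geometric means, obtained from `x ≤ exp (x - 1)`. -/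
theorem fEq_mul_pow_le (hh : 0 < h) (n : ℕ) : fEq n h * h ^ h ≤ n ^ h := by
  rcases Nat.eq_zero_or_pos n with rfl | hn
  · have : fEq 0 h = 0 := by
      unfold fEq
      exact Finset.prod_eq_zero (Finset.mem_range.mpr hh) (by simp [equitablePart])
    simp [this]
  have hn' : (0 : ℝ) < n := by exact_mod_cast hn
  have hh' : (0 : ℝ) < h := by exact_mod_cast hh
  have : (fEq n h * h ^ h : ℝ) ≤ n ^ h := by
    unfold fEq
    have h1 : ∏ i ∈ Finset.range h, ((equitablePart n h i : ℝ) * (h / n)) ≤ 1 := by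
      calc ∏ i ∈ Finset.range h, ((equitablePart n h i : ℝ) * (h / n))
          ≤ ∏ i ∈ Finset.range h, Real.exp ((equitablePart n h i : ℝ) * (h / n) - 1) := by
            apply Finset.prod_le_prod (fun _ _ => by positivity)
            intro i _
            have := Real.add_one_le_exp ((equitablePart n h i : ℝ) * (h / n) - 1)
            linarith
        _ = 1 := by
            rw [← Real.exp_sum, Finset.sum_sub_distrib, ← Finset.sum_mul, ← Nat.cast_sum,
              sum_equitablePart n h hh]
            simp [mul_div_cancel₀ _ hn'.ne']
    rw [Finset.prod_mul_distrib, Finset.prod_const, Finset.card_range, div_pow, ← mul_div_assoc,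
      div_le_one (by positivity)] at h1
    push_cast
    exact h1
  exact_mod_cast this

theorem equitablePart_le_two_mul (hh : 0 < h) (hn : h ≤ n) (i : ℕ) :
    equitablePart n h i ≤ 2 * (n / h) := by
  have := Nat.div_pos hn hh
  rcases equitablePart_eq_or n h i with e | e <;> omega

/-! ### Growth of `g` and comparison with `f`. -/

theorem gEq_of_lt (hn : n < h) : gEq n h = 0 := by
  rw [gEq, dif_neg (by omega)]

theorem gEq_of_le (hh : 2 ≤ h) (hn : h ≤ n) :
    gEq n h = fEq n h + ∑ i ∈ Finset.range h, gEq (equitablePart n h i) h := by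
  rw [gEq, dif_pos ⟨hn, hh⟩]

/-- Parts have size at most `2 * (n / h)`, so by induction the recursive terms, multiplied by `h ^
h`, total at most `h * 2 ^ (h + 1) * (n / h) ^ h`. For `h ≥ 8` this is at most `n ^ h`, no more than
the bound for the main term. -/
theorem gEq_mul_pow_le (hh : 8 ≤ h) (n : ℕ) : gEq n h * h ^ h ≤ 2 * n ^ h := by
  induction n using Nat.strong_induction_on with
  | _ n ih =>
    rcases lt_or_ge n h with hn | hn
    · simp [gEq_of_lt hn]
    have h1 : h * 2 ^ (h + 1) ≤ h ^ h := by
      obtain ⟨t, rfl⟩ := Nat.exists_eq_add_of_le hh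
      have h2 : 2 ^ (8 + t + 1) ≤ (8 + t) ^ (7 + t) := by
        calc 2 ^ (8 + t + 1) ≤ 2 ^ (3 * (7 + t)) := Nat.pow_le_pow_right (by norm_num) (by omega)
          _ = 8 ^ (7 + t) := by rw [pow_mul]; norm_num
          _ ≤ _ := Nat.pow_le_pow_left (by omega) _
      calc (8 + t) * 2 ^ (8 + t + 1) ≤ (8 + t) * (8 + t) ^ (7 + t) := by gcongr
        _ = (8 + t) ^ (8 + t) := by rw [← pow_succ']; congr 1; omega
    have hd : h * (n / h) ≤ n := Nat.mul_div_le n h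
    have hS : (∑ i ∈ Finset.range h, gEq (equitablePart n h i) h) * h ^ h ≤ n ^ h := by
      rw [Finset.sum_mul]
      calc ∑ i ∈ Finset.range h, gEq (equitablePart n h i) h * h ^ h
          ≤ ∑ _i ∈ Finset.range h, 2 * (2 * (n / h)) ^ h := by
            apply Finset.sum_le_sum
            intro i _
            refine (ih _ (equitablePart_lt hn (by omega))).trans ?_
            gcongr
            exact equitablePart_le_two_mul (by omega) hn i
        _ = (h * 2 ^ (h + 1)) * (n / h) ^ h := by
            simp only [Finset.sum_const, Finset.card_range, smul_eq_mul]; ring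
        _ ≤ h ^ h * (n / h) ^ h := by gcongr
        _ = (h * (n / h)) ^ h := (mul_pow _ _ _).symm
        _ ≤ n ^ h := by gcongr
    rw [gEq_of_le (by omega) hn, add_mul]
    have := fEq_mul_pow_le (h := h) (by omega) n
    omega

/-- `f(n,h) - g(n-1,h)` is at least `f(n,h) / (2n)`. -/
theorem two_mul_gEq_add_fEq_le (hh : 8 ≤ h) (hn : h ≤ n) (hbig : 4 * n * h * 2 ^ h ≤ h ^ h) :
    2 * n * gEq (n - 1) h + fEq n h ≤ 2 * n * fEq n h := by
  rcases hn.eq_or_lt with rfl | hlt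
  · rw [gEq_of_lt (by omega)]
    nlinarith [Nat.zero_le (fEq h h)]
  obtain ⟨m, rfl⟩ : ∃ m, n = m + 1 := ⟨n - 1, by omega⟩
  have hm : h ≤ m := by omega
  rw [Nat.add_sub_cancel, gEq_of_le (by omega) hm]
  have hstep := fEq_mul_succ_le (h := h) (by omega) hm
  have hfm : fEq m h ≤ fEq (m + 1) h := by
    have : 0 < m := by omega
    nlinarith
  set S := ∑ i ∈ Finset.range h, gEq (equitablePart m h i) h
  have hS : S * h ^ h ≤ h * 2 ^ (h + 1) * fEq m h := by
    rw [Finset.sum_mul]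
    calc ∑ i ∈ Finset.range h, gEq (equitablePart m h i) h * h ^ h
        ≤ ∑ _i ∈ Finset.range h, 2 * (2 * (m / h)) ^ h := by
          apply Finset.sum_le_sum
          intro i _
          refine (gEq_mul_pow_le hh _).trans ?_
          gcongr
          exact equitablePart_le_two_mul (by omega) hm i
      _ = (h * 2 ^ (h + 1)) * (m / h) ^ h := by
          simp only [Finset.sum_const, Finset.card_range, smul_eq_mul]; ring
      _ ≤ _ := by gcongr; exact pow_div_le_fEq m h
  have hS2 : 2 * (m + 1) * S ≤ fEq m h := by
    have hpos : 0 < h ^ h := by positivity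
    refine Nat.le_of_mul_le_mul_right ?_ hpos
    calc 2 * (m + 1) * S * h ^ h = 2 * (m + 1) * (S * h ^ h) := by ring
      _ ≤ 2 * (m + 1) * (h * 2 ^ (h + 1) * fEq m h) := by gcongr
      _ = (4 * (m + 1) * h * 2 ^ h) * fEq m h := by ring
      _ ≤ h ^ h * fEq m h := by gcongr
      _ = _ := by ring
  -- With `n = m + 1`: passing from `f(m,h)` to `f(n,h)` gains `f(n,h)/n`, and the recursive terms
  -- of `g(m,h)` take back at most half of it.
  nlinarith

end EquitableProduct


/-! ### Counting copies that meet a small set often, and transversals that avoid a set. -/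

namespace SimpleGraph

open Classical in
/-- The finite set of all `φ` satisfying `IsCopy H G φ`. -/
noncomputable def copies {h : ℕ} {V : Type*} [Fintype V] (H : SimpleGraph (Fin h))
    (G : SimpleGraph V) : Finset (Fin h → V) :=
  {φ | IsCopy H G φ}

theorem mem_copies {h : ℕ} {V : Type*} [Fintype V] {H : SimpleGraph (Fin h)}
    {G : SimpleGraph V} {φ : Fin h → V} : φ ∈ copies H G ↔ IsCopy H G φ := by
  simp [copies]

variable {h : ℕ} {H : SimpleGraph (Fin h)} {V : Type*} [Fintype V] {G : SimpleGraph V}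

open Classical in
/-- Few sets of `h` vertices contain many vertices of a given small set `Y`. -/
theorem card_powersetCard_filter_le (hh : 0 < h) (hn : h ≤ Fintype.card V) {θ γ : ℝ}
    (hγ : 0 < γ) (hγ1 : γ ≤ 1) (Y : Finset V) (hY : (Y.card : ℝ) ≤ γ * Fintype.card V) :
    ((((Finset.univ : Finset V).powersetCard h).filter
      fun X => θ * h ≤ ((X ∩ Y).card : ℝ)).card : ℝ) ≤
      (16 * γ ^ θ) ^ h * fEq (Fintype.card V) h := by
  set n := Fintype.card V with hndef
  set B := ((Finset.univ : Finset V).powersetCard h).filter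
      fun X => θ * h ≤ ((X ∩ Y).card : ℝ) with hB
  have hh' : (0 : ℝ) < h := by exact_mod_cast hh
  have hn' : (0 : ℝ) < n := by exact_mod_cast hh.trans_le hn
  set y : ℝ := h / n with hy
  have hy0 : 0 < y := by positivity
  -- An exponential moment argument: the total weight is at most `2h`, so all subsets together
  -- contribute at most `∏ (1 + t v) ≤ exp (2h)`, while each counted set contributes at least `y ^ h
  -- * γ⁻¹ ^ (θ * h)`.
  set t : V → ℝ := fun v => y * if v ∈ Y then γ⁻¹ else 1 with ht
  have ht0 : ∀ v, 0 ≤ t v := fun v => by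
    simp only [ht]; split_ifs <;> positivity
  have hlow : (B.card : ℝ) * (y ^ h * γ⁻¹ ^ (θ * h)) ≤ ∑ X ∈ B, ∏ v ∈ X, t v := by
    rw [← nsmul_eq_mul]
    apply Finset.card_nsmul_le_sum
    intro X hX
    rw [hB, Finset.mem_filter, Finset.mem_powersetCard] at hX
    simp only [ht]
    rw [Finset.prod_mul_distrib, Finset.prod_const, hX.1.2, ← Finset.prod_filter,
      Finset.prod_const, Finset.filter_mem_eq_inter]
    gcongr
    rw [← Real.rpow_natCast]
    exact Real.rpow_le_rpow_of_exponent_le ((one_le_inv₀ hγ).mpr hγ1) hX.2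
  have hup : ∑ X ∈ B, ∏ v ∈ X, t v ≤ Real.exp (2 * h) := by
    calc ∑ X ∈ B, ∏ v ∈ X, t v ≤ ∑ X ∈ Finset.univ.powerset, ∏ v ∈ X, t v := by
          apply Finset.sum_le_sum_of_subset_of_nonneg
          · intro X _
            simp
          · intro X _ _
            exact Finset.prod_nonneg fun v _ => ht0 v
      _ = ∏ v, (1 + t v) := (Finset.prod_one_add _).symm
      _ ≤ ∏ v, Real.exp (t v) := by
          apply Finset.prod_le_prod
          · intro v _
            have := ht0 v
            linarith
          · intro v _
            rw [add_comm]
            exact Real.add_one_le_exp _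
      _ = Real.exp (∑ v, t v) := (Real.exp_sum _ _).symm
      _ ≤ Real.exp (2 * h) := by
          apply Real.exp_le_exp.mpr
          simp only [ht]
          rw [← Finset.mul_sum]
          have : ∑ v : V, (if v ∈ Y then γ⁻¹ else 1 : ℝ) ≤ n + n := by
            calc ∑ v : V, (if v ∈ Y then γ⁻¹ else 1 : ℝ)
                ≤ ∑ v : V, ((if v ∈ Y then γ⁻¹ else 0) + 1) := by
                  apply Finset.sum_le_sum
                  intro v _
                  split_ifs <;> linarith
              _ = Y.card * γ⁻¹ + n := by
                  rw [Finset.sum_add_distrib, ← Finset.sum_filter]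
                  simp [hndef]
              _ ≤ γ * n * γ⁻¹ + n := by gcongr
              _ = n + n := by field_simp
          calc y * _ ≤ y * (n + n) := by gcongr
            _ = 2 * h := by rw [hy]; field_simp; ring
  have hexp : Real.exp (2 * h) ≤ 8 ^ h := by
    calc Real.exp (2 * h) = Real.exp 1 ^ (2 * h) := by
          rw [← Real.exp_nat_mul]; push_cast; ring_nf
      _ ≤ 2.8 ^ (2 * h) := by gcongr; have := Real.exp_one_lt_d9; linarith
      _ = (2.8 ^ 2) ^ h := pow_mul _ _ _
      _ ≤ 8 ^ h := by gcongr; norm_num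
  -- The floor `n / h` is at least half of the true quotient. This `2` and the bound `8` for `e ^ 2`
  -- make up the constant `16`.
  have hf : (n : ℝ) ^ h ≤ (2 * h) ^ h * fEq n h := by
    have h1 : n ≤ 2 * h * (n / h) := by
      have h2 := Nat.lt_div_mul_add hh (a := n)
      have h3 := Nat.mul_le_mul_left h (Nat.div_pos hn hh)
      have h4 := mul_comm (n / h) h
      have h5 : 2 * h * (n / h) = h * (n / h) + h * (n / h) := by ring
      simp only [Nat.succ_eq_add_one, zero_add, mul_one] at h3
      omega
    have : n ^ h ≤ (2 * h) ^ h * fEq n h := by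
      calc n ^ h ≤ (2 * h * (n / h)) ^ h := Nat.pow_le_pow_left h1 _
        _ = (2 * h) ^ h * (n / h) ^ h := mul_pow _ _ _
        _ ≤ _ := Nat.mul_le_mul_left _ (pow_div_le_fEq n h)
    exact_mod_cast this
  have hmain := hlow.trans (hup.trans hexp)
  have hγθ : γ⁻¹ ^ (θ * h) = ((γ ^ θ) ^ h)⁻¹ := by
    rw [Real.inv_rpow hγ.le, Real.rpow_mul hγ.le, Real.rpow_natCast]
  rw [hγθ, hy, div_pow] at hmain
  have hg : 0 < (γ ^ θ) ^ h := by positivity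
  calc (B.card : ℝ) = (B.card * (h ^ h / n ^ h * ((γ ^ θ) ^ h)⁻¹)) *
        ((n ^ h / h ^ h) * (γ ^ θ) ^ h) := by field_simp
    _ ≤ 8 ^ h * ((n ^ h / h ^ h) * (γ ^ θ) ^ h) := by gcongr
    _ ≤ 8 ^ h * (((2 * h) ^ h * fEq n h / h ^ h) * (γ ^ θ) ^ h) := by gcongr
    _ = 8 ^ h * ((2 ^ h * fEq n h) * (γ ^ θ) ^ h) := by rw [mul_pow]; field_simp
    _ = _ := by
        rw [mul_pow, show (16 : ℝ) = 8 * 2 by norm_num, mul_pow]; ring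

open Classical in
theorem IsStronglyAsymmetric.card_copies_filter_le (hH : H.IsStronglyAsymmetric) (hh : 100 ≤ h)
    (hn : h ≤ Fintype.card V) {θ γ : ℝ}
    (hγ : 0 < γ) (hγ1 : γ ≤ 1) (Y : Finset V) (hY : (Y.card : ℝ) ≤ γ * Fintype.card V) :
    (((copies H G).filter
      fun φ => θ * h ≤ ((Finset.univ.filter fun k => φ k ∈ Y).card : ℝ)).card : ℝ) ≤
      (16 * γ ^ θ) ^ h * fEq (Fintype.card V) h := by
  refine le_trans ?_ (card_powersetCard_filter_le (by omega) hn (θ := θ) hγ hγ1 Y hY)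
  rw [Nat.cast_le]
  apply Finset.card_le_card_of_injOn (fun φ => Finset.univ.image φ)
  · intro φ hφ
    rw [Finset.mem_coe, Finset.mem_filter, mem_copies] at hφ
    rw [Finset.mem_coe, Finset.mem_filter, Finset.mem_powersetCard,
      Finset.card_image_of_injective _ hφ.1.injective]
    refine ⟨⟨Finset.subset_univ _, by simp⟩, ?_⟩
    convert hφ.2 using 2
    rw [← Finset.card_image_of_injective _ hφ.1.injective]
    congr 1
    ext v
    simp only [Finset.mem_inter, Finset.mem_image, Finset.mem_univ, true_and, Finset.mem_filter]
    constructor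
    · rintro ⟨⟨k, rfl⟩, hv⟩
      exact ⟨k, hv, rfl⟩
    · rintro ⟨k, hv, rfl⟩
      exact ⟨⟨k, rfl⟩, hv⟩
  · intro φ hφ ψ hψ e
    simp only [Finset.coe_filter, mem_copies, Set.mem_ofPred_eq] at hφ hψ
    apply hH.eq_of_range_eq hh hφ.1 hψ.1
    have := congrArg (fun X : Finset V => (X : Set V)) e
    simpa using this

open Classical in
/-- Fixing the images of the vertices of a distinguishing set `Q` determines, for every other
vertex of `G`, at most one vertex of `H` whose image it can be. -/
theorem exists_transversal_classes [Nonempty (Fin h)] {Q : Set (Fin h)}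
    (hQ : IsDistinguishing H Q)
    (A : Finset (Fin h → V)) (hA : ∀ φ ∈ A, IsCopy H G φ) :
    ∃ w : V → Fin h, A.card ≤ Fintype.card V ^ Q.ncard *
      (A.filter fun φ => ∀ k, w (φ k) = k).card := by
  rcases A.eq_empty_or_nonempty with rfl | ⟨φ₁, hφ₁⟩
  · exact ⟨fun _ => Classical.arbitrary _, by simp⟩
  have : Nonempty (Q → V) := ⟨fun q => φ₁ q⟩
  -- The most frequent restriction to `Q`; there are at most `n ^ |Q|` of them.
  obtain ⟨ρ, -, hρ⟩ := Finset.exists_max_image (Finset.univ : Finset (Q → V))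
    (fun ρ => (A.filter fun φ => (fun q : Q => φ q) = ρ).card) Finset.univ_nonempty
  have hcard := Finset.card_le_mul_card_image_of_maps_to (s := A)
    (t := (Finset.univ : Finset (Q → V))) (f := fun φ => fun q : Q => φ q)
    (fun _ _ => Finset.mem_univ _) _ hρ
  rw [Finset.card_univ, Fintype.card_fun, ← Nat.card_eq_fintype_card (α := Q),
    Nat.card_coe_set_eq, mul_comm] at hcard
  -- `M v i` says that `ρ` permits `v` to play `i`. Roles in `Q` are reserved for the images under
  -- `ρ`, and the disjunction keeps these images from roles outside `Q`. Roles outside `Q` are told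
  -- apart by adjacency to `ρ`, because `Q` is distinguishing.
  set M : V → Fin h → Prop := fun v i => ∃ hi : i ∈ Q ∨ ∀ q : Q, v ≠ ρ q,
    (∀ hq : i ∈ Q, v = ρ ⟨i, hq⟩) ∧ (i ∉ Q → ∀ q : Q, G.Adj v (ρ q) ↔ H.Adj i q) with hM
  have hMc : ∀ φ ∈ A.filter fun φ => (fun q : Q => φ q) = ρ, ∀ k, M (φ k) k := by
    intro φ hφ k
    rw [Finset.mem_filter] at hφ
    obtain ⟨hφA, rfl⟩ := hφ
    have hc := hA φ hφA
    refine ⟨?_, fun hq => rfl, fun _ q => hc.adj_iff k q⟩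
    by_cases hk : k ∈ Q
    · exact Or.inl hk
    · refine Or.inr fun q e => hk ?_
      rw [hc.injective e]
      exact q.2
  by_cases hex : ∃ φ, φ ∈ A.filter fun φ => (fun q : Q => φ q) = ρ
  swap
  · refine ⟨fun _ => Classical.arbitrary _, hcard.trans ?_⟩
    rw [Finset.card_eq_zero.mpr (Finset.eq_empty_of_forall_notMem fun φ hφ => hex ⟨φ, hφ⟩)]
    simp
  obtain ⟨φ₀, hφ₀⟩ := hex
  have hρinj : Function.Injective ρ := by
    rw [Finset.mem_filter] at hφ₀
    obtain ⟨hφA, rfl⟩ := hφ₀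
    exact (hA _ hφA).injective.comp Subtype.val_injective
  have hMu : ∀ v i j, M v i → M v j → i = j := by
    rintro v i j ⟨hi, hi1, hi2⟩ ⟨hj, hj1, hj2⟩
    by_cases hiQ : i ∈ Q
    · by_cases hjQ : j ∈ Q
      · have := hρinj ((hi1 hiQ).symm.trans (hj1 hjQ))
        simpa using this
      · rcases hj with hj | hj
        · exact absurd hj hjQ
        · exact absurd (hi1 hiQ) (hj _)
    · by_cases hjQ : j ∈ Q
      · rcases hi with hi | hi
        · exact absurd hi hiQ
        · exact absurd (hj1 hjQ) (hi _)
      · by_contra hne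
        apply hQ i j hiQ hjQ hne
        intro q hq
        have h1 := hi2 hiQ ⟨q, hq⟩
        have h2 := hj2 hjQ ⟨q, hq⟩
        simp only [agreementSet, Set.mem_ofPred_eq, Set.mem_insert_iff, Set.mem_singleton_iff,
          forall_eq_or_imp, forall_eq]
        refine ⟨?_, ?_⟩
        · rintro (rfl | rfl)
          · exact hiQ hq
          · exact hjQ hq
        · rw [H.adj_comm q i, H.adj_comm q j]
          tauto
  refine ⟨fun v => if hv : ∃ i, M v i then hv.choose else Classical.arbitrary _,
    hcard.trans (Nat.mul_le_mul_left _ (Finset.card_le_card ?_))⟩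
  intro φ hφ
  rw [Finset.mem_filter]
  refine ⟨(Finset.mem_filter.mp hφ).1, fun k => ?_⟩
  have hk : ∃ i, M (φ k) i := ⟨k, hMc φ hφ k⟩
  simp only [dif_pos hk]
  exact hMu _ _ _ hk.choose_spec (hMc φ hφ k)

-- Removing `Y` leaves classes of total size at most `(1 - γ) * n`, which costs the factor `2 ^ (γ *
-- h)`. The `3` pays for the index `i`, whose image is pinned to `v` and may lie anywhere.
open Classical in
theorem card_transversals_fixed_le (hh : 0 < h) (hn : h ≤ Fintype.card V) (w : V → Fin h)
    (A : Finset (Fin h → V)) (i : Fin h) (v : V) (Y : Finset V)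
    (hA : ∀ φ ∈ A, φ i = v ∧ ∀ k ≠ i, w (φ k) = k ∧ φ k ∉ Y) {γ : ℝ} (hγ : 0 ≤ γ)
    (hY : γ * Fintype.card V ≤ Y.card) :
    (A.card : ℝ) * 2 ^ (γ * h) ≤ 3 * fEq (Fintype.card V) h := by
  set x : Fin h → ℕ := fun k => (Finset.univ.filter fun u => w u = k ∧ u ∉ Y).card with hx
  have hsub : A ⊆ Fintype.piFinset fun k =>
      if k = i then {v} else Finset.univ.filter fun u => w u = k ∧ u ∉ Y := by
    intro φ hφ
    rw [Fintype.mem_piFinset]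
    intro k
    split_ifs with hk
    · simp [hk, (hA φ hφ).1]
    · simpa using (hA φ hφ).2 k hk
  have hcard : A.card ≤ ∏ k ∈ Finset.univ.erase i, x k := by
    refine (Finset.card_le_card hsub).trans ?_
    rw [Fintype.card_piFinset, ← Finset.mul_prod_erase _ _ (Finset.mem_univ i)]
    simp only [if_true, Finset.card_singleton, one_mul]
    apply le_of_eq
    apply Finset.prod_congr rfl
    intro k hk
    rw [if_neg (Finset.ne_of_mem_erase hk)]
  have hsum : ∑ k ∈ Finset.univ.erase i, x k + Y.card ≤ Fintype.card V := by
    rw [← Finset.card_univ, ← Finset.card_sdiff_add_card_eq_card (Finset.subset_univ Y)]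
    gcongr
    rw [Finset.card_eq_sum_card_fiberwise (f := w) (t := Finset.univ) (by simp)]
    refine (Finset.sum_le_sum_of_subset (Finset.subset_univ _)).trans (le_of_eq ?_)
    apply Finset.sum_congr rfl
    intro k _
    have : ((Finset.univ \ Y).filter fun u => w u = k) =
        Finset.univ.filter fun u => w u = k ∧ u ∉ Y := by
      ext u
      simp [and_comm]
    rw [this]
  have := prod_mul_two_rpow_le hh hn _ x hsum hγ hY
  rw [Finset.card_erase_of_mem (Finset.mem_univ i), Finset.card_univ, Fintype.card_fin,
    Nat.sub_sub_self hh, pow_one] at this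
  calc (A.card : ℝ) * 2 ^ (γ * h) ≤ (∏ k ∈ Finset.univ.erase i, (x k : ℝ)) * 2 ^ (γ * h) := by
        gcongr
        exact_mod_cast hcard
    _ ≤ _ := this
    _ = _ := mul_comm _ _

open Classical in
theorem card_transversals_le (hh : 0 < h) (hn : h ≤ Fintype.card V) (w : V → Fin h)
    (A : Finset (Fin h → V)) (i : Fin h) (Y : Finset V)
    (hA : ∀ φ ∈ A, ∀ k ≠ i, w (φ k) = k ∧ φ k ∉ Y) {γ : ℝ} (hγ : 0 ≤ γ)
    (hY : γ * Fintype.card V ≤ Y.card) :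
    (A.card : ℝ) * 2 ^ (γ * h) ≤ Fintype.card V * (3 * fEq (Fintype.card V) h) := by
  rw [Finset.card_eq_sum_card_fiberwise (f := fun φ => φ i) (t := Finset.univ) (by simp)]
  push_cast
  rw [Finset.sum_mul, ← Finset.card_univ (α := V), ← nsmul_eq_mul]
  apply Finset.sum_le_card_nsmul
  intro v _
  apply card_transversals_fixed_le hh hn w _ i v Y _ hγ hY
  intro φ hφ
  rw [Finset.mem_filter] at hφ
  exact ⟨hφ.2, hA φ hφ.1⟩

open Classical in
/-- In a copy of `H` that contains few vertices of `D`, and otherwise only vertices with few wrong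
neighbors in the copy, each vertex outside `D` plays the role of its class. -/
theorem IsStronglyAsymmetric.class_eq_of_few_wrong (hH : H.IsStronglyAsymmetric)
    (hh : 100 ≤ h) (w : V → Fin h) (D : Finset V) {φ : Fin h → V} (hφ : IsCopy H G φ)
    (hφD : ((Finset.univ.filter fun k => φ k ∈ D).card : ℝ) < 1 / 10 ^ 6 * h)
    (hφN : ∀ i, φ i ∉ D → ((Finset.univ.filter
      fun k => φ k ∈ wrongNeighbors H G w (φ i) (w (φ i))).card : ℝ) < 1 / 10 ^ 6 * h)
    (hφW : ∀ j, ((Finset.univ.filter fun k => w (φ k) = j).card : ℝ) < 1 / 10 ^ 6 * h)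
    (i : Fin h) (hi : φ i ∉ D) : w (φ i) = i := by
  have hh' : (100 : ℝ) ≤ h := by exact_mod_cast hh
  have hwrong : ∀ i, wrongNeighbors H H (fun k => w (φ k)) i (w (φ i)) =
      Finset.univ.filter fun k => φ k ∈ wrongNeighbors H G w (φ i) (w (φ i)) := by
    intro i
    ext k
    simp only [mem_wrongNeighbors, Finset.mem_filter, Finset.mem_univ, true_and, hφ.adj_iff]
  by_contra hne
  have h1 := hH.le_card_wrongNeighbors hh (fun k => w (φ k)) (fun j => ?_) ?_ hne
  · rw [hwrong i] at h1
    have h2 := hφN i hi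
    linarith
  · have h2 := hφW j
    have h3 : ((fun k => w (φ k)) ⁻¹' {j}).ncard =
        (Finset.univ.filter fun k => w (φ k) = j).card := by
      rw [← Set.ncard_coe_finset]
      congr 1
      ext k
      simp
    rw [h3]
    linarith
  -- Vertices outside `D` contribute at most `h / 10 ^ 6` each, and the fewer than `h / 10 ^ 6`
  -- vertices in `D` at most `h` each: at most `2 * h ^ 2 / 10 ^ 6` in total.
  · calc ∑ i, ((wrongNeighbors H H (fun k => w (φ k)) i (w (φ i))).card : ℝ)
        ≤ ∑ i, (1 / 10 ^ 6 * (h : ℝ) + if φ i ∈ D then (h : ℝ) else 0) := by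
          apply Finset.sum_le_sum
          intro i _
          split_ifs with hi
          · have h2 : (wrongNeighbors H H (fun k => w (φ k)) i (w (φ i))).card ≤ h := by
              simpa using Finset.card_le_univ (wrongNeighbors H H (fun k => w (φ k)) i (w (φ i)))
            have h3 : ((wrongNeighbors H H (fun k => w (φ k)) i (w (φ i))).card : ℝ) ≤ h := by
              exact_mod_cast h2
            linarith
          · rw [hwrong i, add_zero]
            exact (hφN i hi).le
      _ = h * (1 / 10 ^ 6 * h) + (Finset.univ.filter fun k => φ k ∈ D).card * h := by
          rw [Finset.sum_add_distrib, ← Finset.sum_filter]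
          simp
      _ ≤ h * (1 / 10 ^ 6 * h) + (1 / 10 ^ 6 * h) * h := by gcongr
      _ ≤ (h : ℝ) ^ 2 / 10 ^ 5 := by
          have : 0 ≤ (h : ℝ) ^ 2 := by positivity
          linarith

open Classical in
theorem IsStronglyAsymmetric.card_biUnion_copies_le (hH : H.IsStronglyAsymmetric)
    (hh : 100 ≤ h) (hn : h ≤ Fintype.card V) {θ γ : ℝ} (hγ : 0 < γ) (hγ1 : γ ≤ 1)
    {ι : Type*} (S : Finset ι) (hS : S.card ≤ Fintype.card V) (Z : ι → Finset V)
    (hZ : ∀ s ∈ S, ((Z s).card : ℝ) ≤ γ * Fintype.card V) :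
    ((S.biUnion fun s => (copies H G).filter
      fun φ => θ * h ≤ ((Finset.univ.filter fun k => φ k ∈ Z s).card : ℝ)).card : ℝ) ≤
      Fintype.card V * ((16 * γ ^ θ) ^ h * fEq (Fintype.card V) h) := by
  refine le_trans (Nat.cast_le.mpr Finset.card_biUnion_le) ?_
  push_cast
  refine (Finset.sum_le_card_nsmul _ _ _ fun s hs =>
    hH.card_copies_filter_le hh hn hγ hγ1 (Z s) (hZ s hs)).trans ?_
  rw [nsmul_eq_mul]
  gcongr

open Classical in
theorem card_le_of_subset_union {α : Type*} {S A B C : Finset α} (hS : S ⊆ A ∪ B ∪ C)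
    {a b c : ℝ} (ha : (A.card : ℝ) ≤ a) (hb : (B.card : ℝ) ≤ b) (hc : (C.card : ℝ) ≤ c) :
    (S.card : ℝ) ≤ a + b + c := by
  have h1 : S.card ≤ A.card + B.card + C.card := (Finset.card_le_card hS).trans
    ((Finset.card_union_le _ _).trans (Nat.add_le_add_right (Finset.card_union_le _ _) _))
  have h2 : (S.card : ℝ) ≤ A.card + B.card + C.card := by exact_mod_cast h1
  linarith

open Classical in
/-- If outside of a small set `D` the graph `G` is close to a blowup of `H`, then in almost all
copies of `H` each vertex outside `D` plays the role of its class. -/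
theorem IsStronglyAsymmetric.card_copies_misplaced_le (hH : H.IsStronglyAsymmetric)
    (hh : 100 ≤ h) (hn : h ≤ Fintype.card V) {γ : ℝ} (hγ : 0 < γ) (hγ1 : γ ≤ 1)
    (w : V → Fin h) (D : Finset V) (hD : (D.card : ℝ) ≤ γ * Fintype.card V)
    (hN : ∀ v ∉ D, ((wrongNeighbors H G w v (w v)).card : ℝ) ≤ γ * Fintype.card V)
    (hW : ∀ k, ((Finset.univ.filter fun v => w v = k).card : ℝ) ≤ γ * Fintype.card V) :
    (((copies H G).filter fun φ => ¬ ∀ i, φ i ∉ D → w (φ i) = i).card : ℝ) ≤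
      (2 * Fintype.card V + 1) *
        ((16 * γ ^ (1 / 10 ^ 6 : ℝ)) ^ h * fEq (Fintype.card V) h) := by
  -- A misplaced copy has many vertices in `D`, in the wrong neighborhood of some vertex outside
  -- `D`, or in one class. These `1 + n + h ≤ 2 * n + 1` sets are all small.
  have h0 := hH.card_copies_filter_le (G := G) (θ := 1 / 10 ^ 6) hh hn hγ hγ1 D hD
  have h1 := hH.card_biUnion_copies_le (G := G) (θ := 1 / 10 ^ 6) hh hn hγ hγ1
    (Finset.univ \ D) (Finset.card_le_univ _) (fun v => wrongNeighbors H G w v (w v))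
    fun v hv => hN v (Finset.mem_sdiff.mp hv).2
  have h2 := hH.card_biUnion_copies_le (G := G) (θ := 1 / 10 ^ 6) hh hn hγ hγ1
    (Finset.univ : Finset (Fin h)) (by simpa using hn)
    (fun k => Finset.univ.filter fun v => w v = k) fun k _ => hW k
  generalize (16 * γ ^ (1 / 10 ^ 6 : ℝ)) ^ h * (fEq (Fintype.card V) h : ℝ) = M at *
  refine (card_le_of_subset_union (fun φ hφ => ?_) h0 h1 h2).trans (le_of_eq (by ring))
  rw [Finset.mem_filter] at hφ
  by_contra hnot
  simp only [Finset.mem_union, Finset.mem_biUnion, not_or, not_exists, not_and,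
    Finset.mem_filter, hφ.1, true_and, not_le, Finset.mem_univ, Finset.mem_sdiff] at hnot
  exact hφ.2 (hH.class_eq_of_few_wrong hh w D (mem_copies.mp hφ.1) hnot.1.1
    (fun i hi => hnot.1.2 (φ i) hi) hnot.2)

end SimpleGraph


/-! ### From approximate to exact blowup structure. -/

namespace SimpleGraph

variable {h : ℕ} {H : SimpleGraph (Fin h)} {V : Type*} [Fintype V] {G : SimpleGraph V}

-- If `Y` were larger, `A` would have size at most `3 * n * f / n ^ (q + 10)`, less than the assumed
-- `f / n ^ (q + 7)` since `3 * n < n ^ 3`.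
open Classical in
theorem card_lt_of_many_transversals (hh : 100 ≤ h) (hn : h ≤ Fintype.card V) {γ : ℝ} (hγ : 0 ≤ γ)
    {q : ℕ} (hP : (Fintype.card V : ℝ) ^ (q + 10) ≤ 2 ^ (γ * h)) (w : V → Fin h)
    (A : Finset (Fin h → V)) (i : Fin h) (Y : Finset V)
    (hA : ∀ φ ∈ A, ∀ k ≠ i, w (φ k) = k ∧ φ k ∉ Y)
    (hAf : fEq (Fintype.card V) h ≤ Fintype.card V ^ (q + 7) * A.card) :
    (Y.card : ℝ) < γ * Fintype.card V := by
  by_contra hY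
  have h1 := card_transversals_le (by omega) hn w A i Y hA hγ (not_lt.mp hY)
  have hf := fEq_pos (by omega) hn
  have hAf' : (fEq (Fintype.card V) h : ℝ) ≤ Fintype.card V ^ (q + 7) * A.card := by
    exact_mod_cast hAf
  have hApos : (0 : ℝ) < A.card := by
    by_contra hA0
    have : A.card = 0 := by
      by_contra hne
      exact hA0 (by exact_mod_cast Nat.pos_of_ne_zero hne)
    rw [this] at hAf
    omega
  have hn' : (100 : ℝ) ≤ Fintype.card V := by exact_mod_cast hh.trans hn
  set n : ℝ := (Fintype.card V : ℝ)
  have h2 : (A.card : ℝ) * n ^ (q + 10) ≤ n * (3 * (n ^ (q + 7) * A.card)) :=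
    calc (A.card : ℝ) * n ^ (q + 10) ≤ A.card * 2 ^ (γ * h) := by gcongr
      _ ≤ _ := h1
      _ ≤ _ := by gcongr
  have h3 : n * (3 * (n ^ (q + 7) * A.card)) = (A.card * n ^ (q + 8)) * 3 := by ring
  have h4 : A.card * n ^ (q + 10) = (A.card * n ^ (q + 8)) * n ^ 2 := by ring
  rw [h3, h4] at h2
  have h5 : n ^ 2 ≤ 3 := le_of_mul_le_mul_left h2 (by positivity)
  nlinarith

open Classical in
theorem exists_classes_of_many_copies (hh : 100 ≤ h) {Q : Set (Fin h)}
    (hQ : IsDistinguishing H Q) (A : Finset (Fin h → V)) (hA : ∀ φ ∈ A, IsCopy H G φ)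
    (hAf : fEq (Fintype.card V) h ≤ Fintype.card V ^ 5 * A.card) :
    ∃ w : V → Fin h, fEq (Fintype.card V) h ≤ Fintype.card V ^ (Q.ncard + 5) *
      (A.filter fun φ => ∀ k, w (φ k) = k).card := by
  have : Nonempty (Fin h) := ⟨⟨0, by omega⟩⟩
  obtain ⟨w, hw⟩ := exists_transversal_classes hQ A hA
  refine ⟨w, hAf.trans ?_⟩
  rw [pow_add, mul_comm (_ ^ Q.ncard), mul_assoc]
  exact Nat.mul_le_mul_left _ hw

open Classical in
/-- If `G` contains many copies of `H`, then apart from few vertices it is close to a blowup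
of `H`. -/
theorem exists_approximate_structure (hh : 100 ≤ h) (hn : h ≤ Fintype.card V) {γ : ℝ} (hγ : 0 ≤ γ)
    {Q : Set (Fin h)} (hQ : IsDistinguishing H Q)
    (hP : (Fintype.card V : ℝ) ^ (Q.ncard + 10) ≤ 2 ^ (γ * h))
    (hG : fEq (Fintype.card V) h ≤ (copies H G).card) :
    ∃ w : V → Fin h,
      (∀ k, ((Finset.univ.filter fun v => w v = k).card : ℝ) ≤ γ * Fintype.card V) ∧
      ((Finset.univ.filter fun v => γ * Fintype.card V ≤
        ((wrongNeighbors H G w v (w v)).card : ℝ)).card : ℝ) ≤ γ * Fintype.card V := by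
  have hn100 := hh.trans hn
  obtain ⟨w, hw⟩ := exists_classes_of_many_copies hh hQ (copies H G)
    (fun φ hφ => mem_copies.mp hφ)
    (hG.trans (Nat.le_mul_of_pos_left _ (by positivity)))
  set n := Fintype.card V with hndef
  set q := Q.ncard
  set T := (copies H G).filter fun φ => ∀ k, w (φ k) = k with hT
  have hTw : ∀ φ ∈ T, ∀ k, w (φ k) = k := fun φ hφ => (Finset.mem_filter.mp hφ).2
  have hTc : ∀ φ ∈ T, IsCopy H G φ := fun φ hφ => mem_copies.mp (Finset.mem_filter.mp hφ).1
  refine ⟨w, fun k => ?_, ?_⟩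
  -- A transversal meets class `k` only at index `k`, so the class is itself an avoided set.
  · refine (card_lt_of_many_transversals hh hn hγ hP w T k _ (fun φ hφ j hj => ⟨hTw φ hφ j, ?_⟩)
      (hw.trans ?_)).le
    · simp [hTw φ hφ j, hj]
    · gcongr <;> omega
  · set D := Finset.univ.filter fun v => γ * n ≤ ((wrongNeighbors H G w v (w v)).card : ℝ) with hD
    set T₁ := T.filter fun φ => ∀ k, φ k ∉ D with hT₁
    -- A copy through `v` in the role `w v` avoids the wrong neighbors of `v`. Those are many for `v
    -- ∈ D`, so few transversals pass through `v`; after discarding them, `D` itself is avoided and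
    -- hence small.
    have hsmall : ∀ v ∈ D, n ^ (q + 7) * (T.filter fun φ => φ (w v) = v).card ≤
        fEq n h := by
      intro v hv
      by_contra hlt
      have h1 := card_lt_of_many_transversals hh hn hγ hP w (T.filter fun φ => φ (w v) = v) (w v)
        (wrongNeighbors H G w v (w v)) (fun φ hφ k _ => ?_) (not_le.mp hlt).le
      · exact absurd h1 (not_lt.mpr (Finset.mem_filter.mp hv).2)
      · rw [Finset.mem_filter] at hφ
        refine ⟨hTw φ hφ.1 k, fun hk => ?_⟩
        rw [mem_wrongNeighbors, hTw φ hφ.1 k] at hk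
        apply hk.2
        conv_lhs => rw [← hφ.2]
        exact (hTc φ hφ.1).adj_iff _ _
    have hsplit : T.card ≤ T₁.card + ∑ v ∈ D, (T.filter fun φ => φ (w v) = v).card := by
      refine le_trans (Finset.card_le_card ?_) ((Finset.card_union_le T₁
        (D.biUnion fun v => T.filter fun φ => φ (w v) = v)).trans
        (Nat.add_le_add_left Finset.card_biUnion_le _))
      intro φ hφ
      rw [Finset.mem_union, Finset.mem_biUnion]
      by_cases hφD : ∀ k, φ k ∉ D
      · exact Or.inl (Finset.mem_filter.mpr ⟨hφ, hφD⟩)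
      · push Not at hφD
        obtain ⟨k, hk⟩ := hφD
        exact Or.inr ⟨φ k, hk, Finset.mem_filter.mpr ⟨hφ, by rw [hTw φ hφ k]⟩⟩
    have hsum : n ^ (q + 7) * ∑ v ∈ D, (T.filter fun φ => φ (w v) = v).card ≤ n * fEq n h := by
      rw [Finset.mul_sum]
      refine (Finset.sum_le_card_nsmul _ _ _ hsmall).trans ?_
      rw [smul_eq_mul]
      exact Nat.mul_le_mul_right _ (Finset.card_le_univ _)
    refine (card_lt_of_many_transversals hh hn hγ hP w T₁ ⟨0, by omega⟩ D (fun φ hφ k _ => ?_)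
      ?_).le
    · rw [Finset.mem_filter] at hφ
      exact ⟨hTw φ hφ.1 k, hφ.2 k⟩
    · have h1 : n ^ 2 * fEq n h ≤ n ^ (q + 7) * T₁.card + n * fEq n h :=
        calc n ^ 2 * fEq n h ≤ n ^ 2 * (n ^ (q + 5) * T.card) := Nat.mul_le_mul_left _ hw
          _ = n ^ (q + 7) * T.card := by ring
          _ ≤ n ^ (q + 7) * (T₁.card + ∑ v ∈ D, (T.filter fun φ => φ (w v) = v).card) :=
            Nat.mul_le_mul_left _ hsplit
          _ ≤ _ := by rw [mul_add]; exact Nat.add_le_add_left hsum _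
      have h2 : (n + 1) * fEq n h ≤ n ^ 2 * fEq n h :=
        Nat.mul_le_mul_right _ (by nlinarith [hn100])
      linarith

/-- The numerical conditions on `γ`, `h`, `n` and the size `q` of a distinguishing set. -/
structure IsAdmissible (h n q : ℕ) (γ : ℝ) : Prop where
  pos : 0 < γ
  le_one : 4 * γ ≤ 1
  rpow_le : 16 * (4 * γ) ^ (1 / 10 ^ 6 : ℝ) ≤ 1 / 4
  hundred_le : 100 ≤ h
  le_card : h ≤ n
  pow_le : (n : ℝ) ^ (q + 10) ≤ 2 ^ (γ * h)

theorem IsAdmissible.pow_ten_le {n q : ℕ} {γ : ℝ} (hadm : IsAdmissible h n q γ) :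
    n ^ 10 ≤ 4 ^ h := by
  have hn : 1 ≤ n := by have := hadm.hundred_le; have := hadm.le_card; omega
  have h1 : (n : ℝ) ^ 10 ≤ 4 ^ h := by
    calc (n : ℝ) ^ 10 ≤ (n : ℝ) ^ (q + 10) := by
          apply pow_le_pow_right₀ (by exact_mod_cast hn) (by omega)
      _ ≤ 2 ^ (γ * h) := hadm.pow_le
      _ ≤ 4 ^ (h : ℝ) := by
          have := hadm.le_one
          have := hadm.pos
          calc (2 : ℝ) ^ (γ * h) ≤ 4 ^ (γ * h) := by
                exact Real.rpow_le_rpow (by norm_num) (by norm_num)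
                  (mul_nonneg (by linarith) (Nat.cast_nonneg h))
            _ ≤ 4 ^ (h : ℝ) := by
                apply Real.rpow_le_rpow_of_exponent_le (by norm_num)
                have : (0 : ℝ) ≤ h := Nat.cast_nonneg h
                nlinarith
      _ = _ := Real.rpow_natCast _ _
  exact_mod_cast h1

open Classical in
/-- Under the numerical conditions, misplaced copies are a tiny proportion. -/
theorem IsStronglyAsymmetric.pow_mul_card_misplaced_le (hH : H.IsStronglyAsymmetric)
    {q : ℕ} {γ δ : ℝ} (hadm : IsAdmissible h (Fintype.card V) q γ) (hδ : 0 < δ) (hδγ : δ ≤ 4 * γ)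
    (w : V → Fin h) (D : Finset V) (hD : (D.card : ℝ) ≤ δ * Fintype.card V)
    (hN : ∀ v ∉ D, ((wrongNeighbors H G w v (w v)).card : ℝ) ≤ δ * Fintype.card V)
    (hW : ∀ k, ((Finset.univ.filter fun v => w v = k).card : ℝ) ≤ δ * Fintype.card V) :
    Fintype.card V ^ 8 * ((copies H G).filter fun φ => ¬ ∀ i, φ i ∉ D → w (φ i) = i).card ≤
      fEq (Fintype.card V) h := by
  have hle := hH.card_copies_misplaced_le hadm.hundred_le hadm.le_card hδ
    (hδγ.trans hadm.le_one) w D hD hN hW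
  have h10 := hadm.pow_ten_le
  have hn : 100 ≤ Fintype.card V := hadm.hundred_le.trans hadm.le_card
  set n := Fintype.card V
  set M := ((copies H G).filter fun φ => ¬ ∀ i, φ i ∉ D → w (φ i) = i).card
  -- The decay `4 ^ (-h)` beats `n ^ 10`; two of these ten powers absorb `2 * n + 1`.
  have h1 : (16 * δ ^ (1 / 10 ^ 6 : ℝ)) ^ h ≤ (1 / 4) ^ h := by
    gcongr
    refine le_trans ?_ hadm.rpow_le
    gcongr
  have h2 : (n : ℝ) ^ 10 ≤ 4 ^ h := by exact_mod_cast h10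
  have hn' : (100 : ℝ) ≤ n := by exact_mod_cast hn
  have h3 : (n : ℝ) ^ 10 * (M : ℝ) ≤ (2 * n + 1) * fEq n h := by
    calc (n : ℝ) ^ 10 * (M : ℝ) ≤ 4 ^ h * ((2 * n + 1) * ((1 / 4) ^ h * fEq n h)) := by
          gcongr
          refine hle.trans ?_
          gcongr
      _ = (4 * (1 / 4) : ℝ) ^ h * ((2 * n + 1) * fEq n h) := by rw [mul_pow]; ring
      _ = _ := by norm_num
  have h4 : (n : ℝ) ^ 2 * ((n : ℝ) ^ 8 * (M : ℝ)) ≤ (n : ℝ) ^ 2 * fEq n h := by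
    calc (n : ℝ) ^ 2 * ((n : ℝ) ^ 8 * (M : ℝ)) = (n : ℝ) ^ 10 * (M : ℝ) := by ring
      _ ≤ ((2 * n + 1) * fEq n h : ℝ) := h3
      _ ≤ _ := by gcongr; nlinarith
  have h5 : (n : ℝ) ^ 8 * (M : ℝ) ≤ fEq n h := le_of_mul_le_mul_left h4 (by positivity)
  exact_mod_cast h5

-- Pigeonhole over the `h ≤ n` roles: of the at least `f/(2n)` members of `B` through `v`, at most
-- `f/n^8` lie outside `A`.
open Classical in
theorem exists_popular_role (hh : 100 ≤ h) (hn : h ≤ Fintype.card V)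
    (A B : Finset (Fin h → V)) (hB : Fintype.card V ^ 8 * (B \ A).card ≤ fEq (Fintype.card V) h)
    (v : V)
    (hv : fEq (Fintype.card V) h ≤
      2 * Fintype.card V * (B.filter fun φ => v ∈ Set.range φ).card) :
    ∃ i, fEq (Fintype.card V) h ≤ Fintype.card V ^ 5 * (A.filter fun φ => φ i = v).card := by
  have hf := fEq_pos (by omega) hn
  have hn100 := hh.trans hn
  set n := Fintype.card V
  by_contra hnot
  push Not at hnot
  have h1 : (B.filter fun φ => v ∈ Set.range φ).card ≤
      (B \ A).card + ∑ i, (A.filter fun φ => φ i = v).card := by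
    refine le_trans (Finset.card_le_card ?_) ((Finset.card_union_le (B \ A)
      (Finset.univ.biUnion fun i => A.filter fun φ => φ i = v)).trans
      (Nat.add_le_add_left Finset.card_biUnion_le _))
    intro φ hφ
    rw [Finset.mem_filter] at hφ
    obtain ⟨hφB, i, hi⟩ := hφ
    rw [Finset.mem_union, Finset.mem_sdiff, Finset.mem_biUnion]
    by_cases hA : φ ∈ A
    · exact Or.inr ⟨i, Finset.mem_univ _, Finset.mem_filter.mpr ⟨hA, hi⟩⟩
    · exact Or.inl ⟨hφB, hA⟩
  have h2 : n ^ 5 * ∑ i, (A.filter fun φ => φ i = v).card ≤ n * fEq n h := by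
    rw [Finset.mul_sum]
    refine (Finset.sum_le_card_nsmul _ _ _ fun i _ => (hnot i).le).trans ?_
    rw [smul_eq_mul, Finset.card_univ, Fintype.card_fin]
    exact Nat.mul_le_mul_right _ hn
  have h3 : n ^ 5 * (B \ A).card ≤ fEq n h :=
    le_trans (Nat.mul_le_mul_right _ (Nat.pow_le_pow_right (by omega) (by omega))) hB
  have h4 : n ^ 5 * fEq n h ≤ (2 * n) * (fEq n h + n * fEq n h) := by
    calc n ^ 5 * fEq n h ≤ n ^ 5 * (2 * n * (B.filter fun φ => v ∈ Set.range φ).card) :=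
          Nat.mul_le_mul_left _ hv
      _ ≤ n ^ 5 * (2 * n * ((B \ A).card + ∑ i, (A.filter fun φ => φ i = v).card)) := by gcongr
      _ = 2 * n * (n ^ 5 * (B \ A).card + n ^ 5 * ∑ i, (A.filter fun φ => φ i = v).card) := by
          ring
      _ ≤ _ := by gcongr
  have h5 : (2 * n) * (1 + n) < n ^ 5 := by
    calc (2 * n) * (1 + n) ≤ n * n * (n * n) := by
          apply Nat.mul_le_mul
          · nlinarith
          · nlinarith
      _ < n * n * (n * n) * n := by
          apply lt_mul_of_one_lt_right _ (by omega)
          have : 0 < n := by omega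
          positivity
      _ = n ^ 5 := by ring
  have h6 : (2 * n) * (fEq n h + n * fEq n h) = (2 * n) * (1 + n) * fEq n h := by ring
  rw [h6] at h4
  exact absurd (Nat.le_of_mul_le_mul_right h4 hf) (not_le.mpr h5)

open Classical in
/-- If `G` contains many copies of `H`, and each vertex is in many copies, then there is a
partition of `G` into classes such that in almost all copies each vertex plays the role of its
class. -/
theorem IsStronglyAsymmetric.exists_classes (hH : H.IsStronglyAsymmetric) {Q : Set (Fin h)}
    (hQ : IsDistinguishing H Q) {γ : ℝ} (hadm : IsAdmissible h (Fintype.card V) Q.ncard γ)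
    (hG : fEq (Fintype.card V) h ≤ (copies H G).card)
    (hmin : ∀ v, fEq (Fintype.card V) h ≤
      2 * Fintype.card V * ((copies H G).filter fun φ => v ∈ Set.range φ).card) :
    ∃ r : V → Fin h, Fintype.card V ^ 8 *
      ((copies H G).filter fun φ => ¬ ∀ i, r (φ i) = i).card ≤ fEq (Fintype.card V) h := by
  have hh := hadm.hundred_le
  have hn := hadm.le_card
  have hγ := hadm.pos
  have hf := fEq_pos (by omega) hn
  obtain ⟨w, hW, hD⟩ := exists_approximate_structure hh hn hγ.le hQ hadm.pow_le hG
  set n := Fintype.card V with hndef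
  set D := Finset.univ.filter fun v => γ * n ≤ ((wrongNeighbors H G w v (w v)).card : ℝ) with hDdef
  have hgood := hH.pow_mul_card_misplaced_le hadm hγ (by linarith) w D hD
    (fun v hv => by
      simp only [hDdef, Finset.mem_filter, Finset.mem_univ, true_and, not_le] at hv
      exact hv.le) hW
  set A := (copies H G).filter fun φ => ∀ i, φ i ∉ D → w (φ i) = i with hA
  have hsdiff : copies H G \ A =
      (copies H G).filter fun φ => ¬ ∀ i, φ i ∉ D → w (φ i) = i := by
    rw [hA, Finset.filter_not]
  rw [← hsdiff] at hgood
  -- The new class of `v` is a role that it plays often; off `D` this is still `w v`, but vertices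
  -- of `D` may be reassigned.
  choose r hr using fun v => exists_popular_role hh hn A (copies H G) hgood v (hmin v)
  have hrw : ∀ v ∉ D, r v = w v := by
    intro v hv
    have hne : (A.filter fun φ => φ (r v) = v).Nonempty := by
      rw [Finset.nonempty_iff_ne_empty]
      intro he
      have := hr v
      rw [he, Finset.card_empty, mul_zero] at this
      exact absurd (hf.trans_le this) (lt_irrefl 0)
    obtain ⟨φ, hφ⟩ := hne
    rw [Finset.mem_filter, hA, Finset.mem_filter] at hφ
    have := hφ.1.2 (r v) (by rwa [hφ.2])
    rw [hφ.2] at this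
    exact this.symm
  have hrN : ∀ v, ((wrongNeighbors H G r v (r v)).card : ℝ) ≤ 4 * γ * n := by
    intro v
    -- The partition `u` depends on `v`. Its transversals through `v` avoid both the wrong neighbors
    -- of `v` under `u` and the vertices outside `D` where `u` and `w` differ; each set has size
    -- below `γ * n`, as does or nearly does `D`, whence the bound `4 * γ * n` under `r`.
    obtain ⟨u, hu⟩ := exists_classes_of_many_copies (G := G) hh hQ
      (A.filter fun φ => φ (r v) = v)
      (fun φ hφ => mem_copies.mp (Finset.mem_filter.mp (Finset.mem_filter.mp hφ).1).1) (hr v)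
    set T := (A.filter fun φ => φ (r v) = v).filter fun φ => ∀ k, u (φ k) = k with hT
    have hTall : ∀ φ ∈ T, IsCopy H G φ ∧ (∀ i, φ i ∉ D → w (φ i) = i) ∧ φ (r v) = v ∧
        ∀ k, u (φ k) = k := by
      intro φ hφ
      rw [hT, Finset.mem_filter, Finset.mem_filter, hA, Finset.mem_filter, mem_copies] at hφ
      exact ⟨hφ.1.1.1, hφ.1.1.2, hφ.1.2, hφ.2⟩
    have hTf : fEq n h ≤ n ^ (Q.ncard + 7) * T.card := hu.trans (by
      gcongr <;> omega)
    have hN₁ := card_lt_of_many_transversals hh hn hγ.le hadm.pow_le u T (r v)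
      (wrongNeighbors H G u v (r v)) (fun φ hφ k _ => by
        obtain ⟨hc, -, hv, hu⟩ := hTall φ hφ
        refine ⟨hu k, fun hk => ?_⟩
        rw [mem_wrongNeighbors, hu k] at hk
        apply hk.2
        conv_lhs => rw [← hv]
        exact hc.adj_iff _ _) hTf
    have hZ := card_lt_of_many_transversals hh hn hγ.le hadm.pow_le u T (r v)
      (Finset.univ.filter fun x => x ∉ D ∧ u x ≠ w x) (fun φ hφ k _ => by
        obtain ⟨-, hw, -, hu⟩ := hTall φ hφ
        refine ⟨hu k, fun hk => ?_⟩
        simp only [Finset.mem_filter, Finset.mem_univ, true_and] at hk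
        exact hk.2 (by rw [hu k, hw k hk.1])) hTf
    have hsub : wrongNeighbors H G r v (r v) ⊆ wrongNeighbors H G u v (r v) ∪
        (Finset.univ.filter fun x => x ∉ D ∧ u x ≠ w x) ∪ D := by
      intro x hx
      simp only [Finset.mem_union, Finset.mem_filter, Finset.mem_univ, true_and]
      by_cases hxD : x ∈ D
      · exact Or.inr hxD
      by_cases hxu : u x = w x
      · left; left
        rw [mem_wrongNeighbors] at hx ⊢
        rwa [hxu, ← hrw x hxD]
      · exact Or.inl (Or.inr ⟨hxD, hxu⟩)
    have := card_le_of_subset_union hsub hN₁.le hZ.le hD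
    have : 0 ≤ γ * n := by positivity
    linarith
  have hrW : ∀ k, ((Finset.univ.filter fun v => r v = k).card : ℝ) ≤ 4 * γ * n := by
    intro k
    have hsub : (Finset.univ.filter fun v => r v = k) ⊆
        (Finset.univ.filter fun v => w v = k) ∪ D ∪ ∅ := by
      intro v hv
      simp only [Finset.mem_union, Finset.mem_filter, Finset.mem_univ, true_and,
        Finset.notMem_empty, or_false] at hv ⊢
      by_cases hvD : v ∈ D
      · exact Or.inr hvD
      · exact Or.inl (by rw [← hrw v hvD, hv])
    have := card_le_of_subset_union hsub (hW k) hD (c := 0) (by simp)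
    have : 0 ≤ γ * n := by positivity
    linarith
  -- Every vertex now has few wrong neighbors, so the exceptional set can be taken empty.
  have hfin := hH.pow_mul_card_misplaced_le (G := G) hadm (δ := 4 * γ) (by linarith) le_rfl r ∅
    (by simp; positivity) (fun v _ => hrN v) hrW
  refine ⟨r, ?_⟩
  simpa using hfin

open Classical in
theorem card_transversals_le_prod (w : V → Fin h) (T : Finset (Fin h → V))
    (hT : ∀ φ ∈ T, ∀ k, w (φ k) = k) :
    T.card ≤ ∏ k, (Finset.univ.filter fun v => w v = k).card := by
  rw [← Fintype.card_piFinset]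
  apply Finset.card_le_card
  intro φ hφ
  rw [Fintype.mem_piFinset]
  intro k
  simp [hT φ hφ k]

-- The transversals of the partition through both `u` and `v` are all missing from `T`, and they are
-- at least a share `1/n^2` of all.
open Classical in
theorem card_transversals_avoiding_pair_le (w : V → Fin h) (T : Finset (Fin h → V))
    (hT : ∀ φ ∈ T, ∀ k, w (φ k) = k) {u v : V} (huv : w u ≠ w v)
    (hTuv : ∀ φ ∈ T, φ (w u) = u → φ (w v) ≠ v) :
    Fintype.card V ^ 2 * T.card + ∏ k, (Finset.univ.filter fun x => w x = k).card ≤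
      Fintype.card V ^ 2 * ∏ k, (Finset.univ.filter fun x => w x = k).card := by
  set x : Fin h → ℕ := fun k => (Finset.univ.filter fun x => w x = k).card with hx
  set S : Fin h → Finset V := fun k => if k = w u then {u} else if k = w v then {v} else
    Finset.univ.filter fun x => w x = k with hS
  have hmem : w v ∈ Finset.univ.erase (w u) := by simp [huv.symm]
  set P := ∏ k ∈ (Finset.univ.erase (w u)).erase (w v), x k with hPdef
  have hSP : (Fintype.piFinset S).card = P := by
    rw [Fintype.card_piFinset, ← Finset.mul_prod_erase _ _ (Finset.mem_univ (w u)),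
      ← Finset.mul_prod_erase _ _ hmem]
    simp only [hS, if_true, Finset.card_singleton, one_mul, if_neg huv.symm]
    apply Finset.prod_congr rfl
    intro k hk
    simp only [Finset.mem_erase, Finset.mem_univ, and_true] at hk
    rw [if_neg hk.2, if_neg hk.1]
  have hxP : ∏ k, x k = x (w u) * (x (w v) * P) := by
    rw [hPdef, Finset.mul_prod_erase _ _ hmem, Finset.mul_prod_erase _ _ (Finset.mem_univ (w u))]
  have hle : T.card + P ≤ ∏ k, x k := by
    rw [← hSP, ← Finset.card_union_of_disjoint]
    · apply card_transversals_le_prod w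
      intro φ hφ k
      rw [Finset.mem_union] at hφ
      rcases hφ with hφ | hφ
      · exact hT φ hφ k
      · rw [Fintype.mem_piFinset] at hφ
        have := hφ k
        simp only [hS] at this
        split_ifs at this with h1 h2
        · rw [Finset.mem_singleton.mp this, h1]
        · rw [Finset.mem_singleton.mp this, h2]
        · simpa using this
    · rw [Finset.disjoint_left]
      intro φ hφ hφS
      rw [Fintype.mem_piFinset] at hφS
      apply hTuv φ hφ
      · have := hφS (w u)
        simpa [hS] using this
      · have := hφS (w v)
        simpa [hS, huv.symm] using this
  have hxx : ∏ k, x k ≤ Fintype.card V ^ 2 * P := by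
    rw [hxP, ← mul_assoc, pow_two]
    gcongr <;> exact Finset.card_le_univ _
  calc Fintype.card V ^ 2 * T.card + ∏ k, x k ≤ Fintype.card V ^ 2 * T.card +
        Fintype.card V ^ 2 * P := by gcongr
    _ = Fintype.card V ^ 2 * (T.card + P) := by ring
    _ ≤ _ := by gcongr

open Classical in
theorem ncard_preimage_eq_card_filter {W : Type*} (c : V → W) (k : W) :
    (c ⁻¹' {k}).ncard = (Finset.univ.filter fun v => c v = k).card := by
  rw [← Set.ncard_coe_finset]
  congr 1
  ext v
  simp

open Classical in
theorem sum_card_filter_eq (w : V → Fin h) :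
    ∑ k, (Finset.univ.filter fun v => w v = k).card = Fintype.card V := by
  rw [← Finset.card_univ]
  exact (Finset.card_eq_sum_card_fiberwise (by simp)).symm

open Classical in
/-- A graph with at least `f(n,h)` copies of `H`, in which each vertex is in many copies, is
obtained from a balanced blowup of `H` by adding edges inside parts. -/
theorem IsStronglyAsymmetric.isFilledBalancedBlowup (hH : H.IsStronglyAsymmetric) {Q : Set (Fin h)}
    (hQ : IsDistinguishing H Q) {γ : ℝ} (hadm : IsAdmissible h (Fintype.card V) Q.ncard γ)
    (hG : fEq (Fintype.card V) h ≤ (copies H G).card)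
    (hmin : ∀ v, fEq (Fintype.card V) h ≤
      2 * Fintype.card V * ((copies H G).filter fun φ => v ∈ Set.range φ).card) :
    H.IsFilledBalancedBlowup G := by
  have hh := hadm.hundred_le
  have hn := hadm.le_card
  have hf := fEq_pos (by omega) hn
  obtain ⟨w, hw⟩ := hH.exists_classes hQ hadm hG hmin
  have hsum := sum_card_filter_eq w
  have hsplit := Finset.card_filter_add_card_filter_not (s := copies H G)
    (fun φ => ∀ i, w (φ i) = i)
  set T := (copies H G).filter fun φ => ∀ i, w (φ i) = i with hT
  set M := ((copies H G).filter fun φ => ¬ ∀ i, w (φ i) = i).card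
  have hTw : ∀ φ ∈ T, ∀ k, w (φ k) = k := fun φ hφ => (Finset.mem_filter.mp hφ).2
  have hTprod := card_transversals_le_prod w T hTw
  set n := Fintype.card V with hndef
  set x : Fin h → ℕ := fun k => (Finset.univ.filter fun v => w v = k).card with hx
  have hn100 : 100 ≤ n := hh.trans hn
  -- Misplaced copies cannot make up for losing a share `1/(n^2 + 1)` of the transversals. This
  -- rules out unbalanced parts (`hbal`) and wrong pairs (`hadj`).
  have hM : (n ^ 2 + 1) * M < fEq n h := by
    rcases Nat.eq_zero_or_pos M with h0 | hpos
    · rw [h0, mul_zero]; exact hf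
    · refine lt_of_lt_of_le ?_ hw
      apply Nat.mul_lt_mul_of_pos_right _ hpos
      calc n ^ 2 + 1 < n ^ 3 := by nlinarith
        _ ≤ n ^ 8 := Nat.pow_le_pow_right (by omega) (by omega)
  have hle : fEq n h ≤ T.card + M := by omega
  have hprodf : ∏ k, x k ≤ fEq n h := prod_le_fEq (by omega) hn x hsum.le
  have hbal : ∀ i j, x i ≤ x j + 1 := by
    intro i j
    by_contra hij
    have h1 := prod_mul_le_of_not_balanced (by omega) hn x hsum (not_le.mp hij)
    have h2 : (n ^ 2 + 1) * fEq n h ≤ (∏ k, x k) * (n ^ 2 + 1) + (n ^ 2 + 1) * M := by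
      calc (n ^ 2 + 1) * fEq n h ≤ (n ^ 2 + 1) * (T.card + M) := by gcongr
        _ ≤ (n ^ 2 + 1) * (∏ k, x k + M) := by gcongr
        _ = _ := by ring
    linarith
  have hprod : ∏ k, x k = fEq n h := prod_eq_fEq_of_balanced (by omega) hn x hsum hbal
  have hadj : ∀ u v, w u ≠ w v → (G.Adj u v ↔ H.Adj (w u) (w v)) := by
    intro u v huv
    by_contra hne
    have h1 := card_transversals_avoiding_pair_le w T hTw huv (by
      intro φ hφ hu hv
      apply hne
      conv_lhs => rw [← hu, ← hv]
      exact (mem_copies.mp (Finset.mem_filter.mp hφ).1).adj_iff _ _)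
    have h2 : n ^ 2 * fEq n h ≤ n ^ 2 * T.card + n ^ 2 * M := by
      rw [← mul_add]
      gcongr
    change n ^ 2 * T.card + ∏ k, x k ≤ n ^ 2 * ∏ k, x k at h1
    rw [hprod] at h1
    nlinarith
  refine ⟨w, ⟨fun k => ?_, fun i j => ?_⟩, fun u v huv => ?_, fun u v huv hb => ?_⟩
  · have hxk : x k ≠ 0 := by
      intro h0
      rw [← hprod, Finset.prod_eq_zero (Finset.mem_univ k) h0] at hf
      exact absurd hf (lt_irrefl 0)
    obtain ⟨v, hv⟩ := Finset.card_pos.mp (Nat.pos_of_ne_zero hxk)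
    exact ⟨v, by simpa using hv⟩
  · rw [ncard_preimage_eq_card_filter, ncard_preimage_eq_card_filter]
    convert hbal i j
  · have huv' : H.Adj (w u) (w v) := huv
    exact (hadj u v huv'.ne).mpr huv'
  · by_contra hne
    exact hb ((hadj u v hne).mp huv)

end SimpleGraph


/-! ### Copies in filled and nested blowups, and the induction. -/

namespace SimpleGraph

universe u

variable {h : ℕ} {H : SimpleGraph (Fin h)} {V : Type u}

theorem IsFilledBlowup.adj_iff {c : V → Fin h} {G : SimpleGraph V}
    (hG : IsFilledBlowup H c G) {u v : V} (huv : c u ≠ c v) :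
    G.Adj u v ↔ H.Adj (c u) (c v) := by
  constructor
  · intro hadj
    by_contra hn
    exact huv (hG.2 u v hadj hn)
  · intro hadj
    exact hG.1 hadj

namespace IsStronglyAsymmetric

theorem card_copies_eq (hH : H.IsStronglyAsymmetric) (hh : 100 ≤ h) [Fintype V]
    (G : SimpleGraph V) : (copies H G).card = H.inducedCopies G :=
  (hH.inducedCopies_eq hh G).symm

open Classical in
theorem inducedCopies_induce (hH : H.IsStronglyAsymmetric) (hh : 100 ≤ h) [Fintype V]
    (G : SimpleGraph V) (s : Set V) :
    H.inducedCopies (G.induce s) = ((copies H G).filter fun φ => ∀ k, φ k ∈ s).card := by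
  have : Fintype s := Fintype.ofFinite s
  rw [← hH.card_copies_eq hh]
  refine Finset.card_bij (fun φ _ k => (φ k : V)) ?_ ?_ ?_
  · intro φ hφ
    rw [mem_copies] at hφ
    rw [Finset.mem_filter, mem_copies]
    exact ⟨⟨Subtype.val_injective.comp hφ.injective, hφ.adj_iff⟩, fun k => (φ k).2⟩
  · intro φ _ ψ _ e
    funext k
    exact Subtype.ext (congrFun e k)
  · intro φ hφ
    rw [Finset.mem_filter, mem_copies] at hφ
    refine ⟨fun k => ⟨φ k, hφ.2 k⟩, mem_copies.mpr ⟨fun i j e => ?_, hφ.1.adj_iff⟩, rfl⟩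
    exact hφ.1.injective (congrArg Subtype.val e)

open Classical in
theorem inducedCopies_eq_add_deletion (hH : H.IsStronglyAsymmetric) (hh : 100 ≤ h) [Fintype V]
    (G : SimpleGraph V) (v : V) :
    H.inducedCopies G = H.inducedCopies (G.induce {v}ᶜ) +
      ((copies H G).filter fun φ => v ∈ Set.range φ).card := by
  rw [hH.inducedCopies_induce hh, ← hH.card_copies_eq hh,
    ← Finset.card_filter_add_card_filter_not (s := copies H G) fun φ => ∀ k, φ k ∈ ({v}ᶜ : Set V)]
  congr 2 <;> (ext φ; simp)

/-- The graph `H` is not a blowup in a nontrivial way. -/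
theorem eq_id_or_const (hH : H.IsStronglyAsymmetric) (hh : 1000 ≤ h) (d : Fin h → Fin h)
    (hd : ∀ i j, d i ≠ d j → (H.Adj i j ↔ H.Adj (d i) (d j))) :
    (∀ i, d i = i) ∨ ∃ j, ∀ i, d i = j := by
  have hh' : (1000 : ℝ) ≤ h := by exact_mod_cast hh
  by_cases hfib : ∀ j, ((d ⁻¹' {j}).ncard : ℝ) ≤ h / 100
  · left
    apply hH.eq_id_of_wrongNeighbors_eq_empty (by omega) d hfib
    intro i
    ext k
    rw [mem_wrongNeighbors]
    simp only [Finset.notMem_empty, iff_false, not_and, not_not]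
    exact fun hk => hd i k hk.symm
  right
  push Not at hfib
  obtain ⟨j, hj⟩ := hfib
  refine ⟨j, ?_⟩
  by_contra hx
  push Not at hx
  obtain ⟨x, hx⟩ := hx
  -- A fibre with at least three elements: every vertex outside agrees on it, so by
  -- `agreement_triple` its complement has at most `0.3h` elements. A vertex outside is joined to
  -- all of the fibre or to none, contradicting the degree bounds.
  set P := d ⁻¹' {j} with hP
  have hout : ∀ y ∉ P, ∀ p ∈ P, (H.Adj y p ↔ H.Adj (d y) j) := by
    intro y hy p hp
    have hp' : d p = j := hp
    have := hd y p (by rw [hp']; exact hy)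
    rwa [hp'] at this
  have h3 : 3 ≤ P.ncard := by
    have : (3 : ℝ) < P.ncard := by linarith
    exact_mod_cast this.le
  obtain ⟨S, hSP, hS⟩ := Set.exists_subset_card_eq h3
  have hag := hH.agreement_triple S hS
  have hsub : Pᶜ ⊆ agreementSet H S := by
    intro y hy
    refine ⟨fun hyS => hy (hSP hyS), ?_⟩
    by_cases hadj : H.Adj (d y) j
    · exact Or.inl fun s hs => (hout y hy s (hSP hs)).mpr hadj
    · exact Or.inr fun s hs => fun ha => hadj ((hout y hy s (hSP hs)).mp ha)
  have hc : ((Pᶜ).ncard : ℝ) ≤ 0.3 * h :=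
    le_trans (by exact_mod_cast Set.ncard_le_ncard hsub (Set.toFinite _)) hag
  have hPc : (P.ncard : ℝ) + (Pᶜ).ncard = h := by
    have := Set.ncard_add_ncard_compl P
    rw [Nat.card_eq_fintype_card, Fintype.card_fin] at this
    exact_mod_cast this
  have hdeg := hH.degree x
  have hxP : x ∉ P := hx
  by_cases hadj : H.Adj (d x) j
  · have : P ⊆ H.neighborSet x := fun p hp => (hout x hxP p hp).mpr hadj
    have h1 : (P.ncard : ℝ) ≤ (H.neighborSet x).ncard := by
      exact_mod_cast Set.ncard_le_ncard this (Set.toFinite _)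
    linarith
  · have : H.neighborSet x ⊆ Pᶜ := fun p hp hpP => hadj ((hout x hxP p hpP).mp hp)
    have h1 : ((H.neighborSet x).ncard : ℝ) ≤ (Pᶜ).ncard := by
      exact_mod_cast Set.ncard_le_ncard this (Set.toFinite _)
    linarith

-- Composing a copy with `c` gives a self-map of `Fin h` as in `eq_id_or_const`. If it is the
-- identity, the copy is transversal with each vertex in its own role; if it is constant, the copy
-- lies in one part.
open Classical in
theorem inducedCopies_filledBlowup (hH : H.IsStronglyAsymmetric) (hh : 1000 ≤ h) [Fintype V]
    (hn : h ≤ Fintype.card V) {G : SimpleGraph V} {c : V → Fin h} (hc : IsEquitable c)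
    (hG : IsFilledBlowup H c G) :
    H.inducedCopies G = fEq (Fintype.card V) h + ∑ i, H.inducedCopies (G.induce (c ⁻¹' {i})) := by
  have htrans : ((copies H G).filter fun φ => ∀ k, c (φ k) = k).card = fEq (Fintype.card V) h := by
    have : ((copies H G).filter fun φ => ∀ k, c (φ k) = k) =
        Fintype.piFinset fun k => Finset.univ.filter fun v => c v = k := by
      ext φ
      simp only [Finset.mem_filter, mem_copies, Fintype.mem_piFinset, Finset.mem_univ, true_and,
        and_iff_right_iff_imp]
      intro hφ
      refine ⟨fun i j e => by rw [← hφ i, ← hφ j, e], fun i j => ?_⟩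
      by_cases hij : i = j
      · simp [hij]
      · rw [hG.adj_iff (by rw [hφ, hφ]; exact hij), hφ, hφ]
    rw [this, Fintype.card_piFinset]
    apply prod_eq_fEq_of_balanced (by omega) hn _ (sum_card_filter_eq c)
    intro i j
    have := hc.2 i j
    rw [ncard_preimage_eq_card_filter, ncard_preimage_eq_card_filter] at this
    convert this
  have hrest : ((copies H G).filter fun φ => ¬ ∀ k, c (φ k) = k) =
      Finset.univ.biUnion fun i => (copies H G).filter fun φ => ∀ k, φ k ∈ c ⁻¹' {i} := by
    ext φ
    simp only [Finset.mem_filter, Finset.mem_biUnion, Finset.mem_univ, true_and,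
      Set.mem_preimage, Set.mem_singleton_iff]
    constructor
    · rintro ⟨hφ, hne⟩
      rcases hH.eq_id_or_const hh (fun k => c (φ k)) (fun i j hij => by
        rw [← (mem_copies.mp hφ).adj_iff i j, hG.adj_iff hij]) with h1 | ⟨j, hj⟩
      · exact absurd h1 hne
      · exact ⟨j, hφ, hj⟩
    · rintro ⟨i, hφ, hi⟩
      refine ⟨hφ, fun hid => ?_⟩
      have h0 := (hid ⟨0, by omega⟩).symm.trans (hi _)
      have h1 := (hid ⟨1, by omega⟩).symm.trans (hi _)
      have := h0.trans h1.symm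
      simp at this
  rw [← hH.card_copies_eq (by omega),
    ← Finset.card_filter_add_card_filter_not (s := copies H G) fun φ => ∀ k, c (φ k) = k,
    htrans, hrest, Finset.card_biUnion]
  · congr 1
    apply Finset.sum_congr rfl
    intro i _
    rw [hH.inducedCopies_induce (by omega)]
  · intro i _ j _ hij
    rw [Function.onFun, Finset.disjoint_left]
    intro φ hφ hφ'
    rw [Finset.mem_filter] at hφ hφ'
    exact hij ((hφ.2 ⟨0, by omega⟩).symm.trans (hφ'.2 ⟨0, by omega⟩))

end IsStronglyAsymmetric

theorem exists_isEquitable [Finite V] (hh : 0 < h) (hn : h ≤ Nat.card V) :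
    ∃ c : V → Fin h, IsEquitable c := by
  have := Fintype.ofFinite V
  rw [Nat.card_eq_fintype_card] at hn
  set n := Fintype.card V
  have hcard : Fintype.card V = Fintype.card (Σ i : Fin h, Fin (equitablePart n h i)) := by
    simp [sum_fin_equitablePart hh, n]
  let e := Fintype.equivOfCardEq hcard
  have hfib : ∀ i : Fin h, ((fun v => (e v).1) ⁻¹' {i}).ncard = equitablePart n h i := by
    intro i
    have : (fun v => (e v).1) ⁻¹' {i} =
        (fun t => e.symm ⟨i, t⟩) '' (Set.univ : Set (Fin (equitablePart n h i))) := by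
      ext v
      simp only [Set.mem_preimage, Set.mem_singleton_iff, Set.image_univ, Set.mem_range]
      constructor
      · rintro rfl
        exact ⟨(e v).2, by simp⟩
      · rintro ⟨t, rfl⟩
        simp
    rw [this, Set.ncard_image_of_injective, Set.ncard_univ, Nat.card_eq_fintype_card,
      Fintype.card_fin]
    intro s t hst
    simpa using hst
  refine ⟨fun v => (e v).1, fun i => ?_, fun i j => ?_⟩
  · have hpos : 0 < ((fun v => (e v).1) ⁻¹' {i}).ncard := by
      rw [hfib]
      have := Nat.div_pos hn hh
      unfold equitablePart
      omega
    exact Set.nonempty_of_ncard_ne_zero hpos.ne'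
  · rw [hfib, hfib]
    rcases equitablePart_eq_or n h i with e1 | e1 <;>
      rcases equitablePart_eq_or n h j with e2 | e2 <;> omega

theorem IsEquitable.card_preimage_lt [Finite V] {c : V → Fin h} (hh : 2 ≤ h)
    (hc : IsEquitable c) (i : Fin h) : Nat.card (c ⁻¹' {i}) < Nat.card V := by
  have : Nontrivial (Fin h) := Fin.nontrivial_iff_two_le.mpr hh
  obtain ⟨j, hj⟩ := exists_ne i
  obtain ⟨v, rfl⟩ := hc.1 j
  rw [Nat.card_coe_set_eq, ← Set.ncard_univ]
  exact Set.ncard_lt_ncard ⟨Set.subset_univ _, fun hs => hj (hs (Set.mem_univ v))⟩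

theorem IsEquitable.sum_preimage [Finite V] {c : V → Fin h} (hh : 0 < h)
    (hc : IsEquitable c) (F : ℕ → ℕ) : ∑ i, F (Nat.card (c ⁻¹' {i})) =
      ∑ i ∈ Finset.range h, F (equitablePart (Nat.card V) h i) := by
  classical
  have := Fintype.ofFinite V
  apply sum_eq_of_balanced hh
  · rw [Nat.card_eq_fintype_card, ← sum_card_filter_eq c]
    apply Finset.sum_congr rfl
    intro i _
    rw [Nat.card_coe_set_eq, ncard_preimage_eq_card_filter]
    convert rfl
  · intro i j
    rw [Nat.card_coe_set_eq, Nat.card_coe_set_eq]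
    exact hc.2 i j

theorem exists_isNestedBalancedBlowup (hh : 2 ≤ h) (H : SimpleGraph (Fin h)) (n : ℕ) :
    ∀ (V : Type u) [Finite V], Nat.card V = n → ∃ G : SimpleGraph V,
      H.IsNestedBalancedBlowup G := by
  induction n using Nat.strong_induction_on with
  | _ n ih =>
    intro V _ hV
    rcases lt_or_ge n h with hn | hn
    · exact ⟨⊥, .small _ (by omega)⟩
    obtain ⟨c, hc⟩ := exists_isEquitable (V := V) (h := h) (by omega) (by omega)
    have hex : ∀ i, ∃ G : SimpleGraph (c ⁻¹' {i}), H.IsNestedBalancedBlowup G := fun i =>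
      ih _ (hV ▸ hc.card_preimage_lt hh i) _ rfl
    choose Gs hGs using hex
    let G : SimpleGraph V :=
      { Adj := fun u v => H.Adj (c u) (c v) ∨
          ∃ (i : Fin h) (hu : u ∈ c ⁻¹' {i}) (hv : v ∈ c ⁻¹' {i}), (Gs i).Adj ⟨u, hu⟩ ⟨v, hv⟩
        symm := ⟨by
          rintro u v (huv | ⟨i, hu, hv, huv⟩)
          · exact Or.inl huv.symm
          · exact Or.inr ⟨i, hv, hu, huv.symm⟩⟩
        loopless := ⟨by
          rintro u (huv | ⟨i, hu, hv, huv⟩)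
          · exact huv.ne rfl
          · exact huv.ne rfl⟩ }
    refine ⟨G, .nest G (by omega) c hc ⟨fun u v huv => Or.inl huv, ?_⟩ fun i => ?_⟩
    · rintro u v (huv | ⟨i, hu, hv, -⟩) hb
      · exact absurd huv hb
      · exact hu.trans hv.symm
    · convert hGs i
      ext ⟨u, hu⟩ ⟨v, hv⟩
      constructor
      · rintro (huv | ⟨j, hu', hv', huv⟩)
        · have hu1 : c u = i := hu
          have hv1 : c v = i := hv
          simp only [Function.Embedding.subtype_apply, hu1, hv1] at huv
          exact absurd rfl huv.ne
        · obtain rfl : j = i := hu'.symm.trans hu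
          exact huv
      · intro huv
        exact Or.inr ⟨i, hu, hv, huv⟩

theorem inducedCopies_eq_zero [Finite V] (hV : Nat.card V < h) (G : SimpleGraph V) :
    H.inducedCopies G = 0 := by
  have : {S : Set V | Nonempty (H ≃g G.induce S)} = ∅ := by
    rw [Set.eq_empty_iff_forall_notMem]
    rintro S ⟨e⟩
    have h1 := Nat.card_le_card_of_injective _ (Subtype.val_injective.comp e.injective)
    rw [Nat.card_eq_fintype_card, Fintype.card_fin] at h1
    omega
  rw [inducedCopies, this, Set.ncard_empty]

theorem IsAdmissible.four_mul_le {n q : ℕ} {γ : ℝ} (hadm : IsAdmissible h n q γ) :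
    4 * n * h * 2 ^ h ≤ h ^ h := by
  have h1 := hadm.hundred_le
  have h2 := hadm.le_card
  calc 4 * n * h * 2 ^ h ≤ n * n * n * 2 ^ h := by
        gcongr
        omega
    _ = n ^ 3 * 2 ^ h := by ring
    _ ≤ n ^ 10 * 2 ^ h := by
        gcongr
        · omega
        · norm_num
    _ ≤ 4 ^ h * 2 ^ h := Nat.mul_le_mul_right _ hadm.pow_ten_le
    _ = 8 ^ h := by rw [← mul_pow]; norm_num
    _ ≤ h ^ h := Nat.pow_le_pow_left (by omega) _

/-- The three claims are proved together: the structure at `n` uses the upper bound at `n - 1`, and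
the bound and equality case at `n` use those of the parts. Hence admissibility is required for all
sizes up to `N`, with the same `Q` and `γ`. -/
theorem IsStronglyAsymmetric.extremal (hH : H.IsStronglyAsymmetric) (hh : 1000 ≤ h)
    {Q : Set (Fin h)} (hQ : IsDistinguishing H Q) {γ : ℝ} {N : ℕ}
    (hadm : ∀ n, h ≤ n → n ≤ N → IsAdmissible h n Q.ncard γ) (n : ℕ) (hnN : n ≤ N) :
    ∀ (V : Type u) [Finite V], Nat.card V = n → ∀ G : SimpleGraph V,
      H.inducedCopies G ≤ gEq n h ∧
      (H.inducedCopies G = gEq n h ↔ H.IsNestedBalancedBlowup G) ∧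
      (h ≤ n → fEq n h ≤ H.inducedCopies G → H.IsFilledBalancedBlowup G) := by
  induction n using Nat.strong_induction_on with
  | _ n ih =>
    intro V _ hV G
    rcases lt_or_ge n h with hn | hn
    · rw [inducedCopies_eq_zero (by omega), gEq_of_lt hn]
      exact ⟨le_rfl, ⟨fun _ => .small _ (by omega), fun _ => rfl⟩, fun hle => by omega⟩
    have := Fintype.ofFinite V
    have hV' : Fintype.card V = n := by rw [← hV, Nat.card_eq_fintype_card]
    have hg := gEq_of_le (by omega) hn
    have hformula : ∀ c : V → Fin h, IsEquitable c → IsFilledBlowup H c G →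
        H.inducedCopies G = fEq n h + ∑ i, H.inducedCopies (G.induce (c ⁻¹' {i})) := by
      intro c hc hG
      have := hH.inducedCopies_filledBlowup hh (by omega) hc hG
      rwa [hV'] at this
    have hparts : ∀ c : V → Fin h, IsEquitable c → ∀ i,
        H.inducedCopies (G.induce (c ⁻¹' {i})) ≤ gEq (Nat.card (c ⁻¹' {i})) h ∧
        (H.inducedCopies (G.induce (c ⁻¹' {i})) = gEq (Nat.card (c ⁻¹' {i})) h ↔
          H.IsNestedBalancedBlowup (G.induce (c ⁻¹' {i}))) := by
      intro c hc i
      have hlt := hc.card_preimage_lt (by omega) i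
      have := ih _ (by omega) (by omega) _ rfl (G.induce (c ⁻¹' {i}))
      exact ⟨this.1, this.2.1⟩
    have hgsum : ∀ c : V → Fin h, IsEquitable c →
        gEq n h = fEq n h + ∑ i, gEq (Nat.card (c ⁻¹' {i})) h := by
      intro c hc
      rw [hg, hc.sum_preimage (by omega) (fun x => gEq x h), hV]
    -- At most `g(n-1,h)` copies survive the deletion of `v`, so at least `f(n,h)/(2n)` contain it.
    have hfilled : fEq n h ≤ H.inducedCopies G → H.IsFilledBalancedBlowup G := by
      intro hf
      have hadm' := hadm n hn hnN
      refine hH.isFilledBalancedBlowup hQ (hV' ▸ hadm') ?_ fun v => ?_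
      · rwa [hV', hH.card_copies_eq (by omega)]
      · rw [hV']
        have hdel := hH.inducedCopies_eq_add_deletion (by omega) G v
        have hcard : Nat.card ({v}ᶜ : Set V) = n - 1 := by
          rw [Nat.card_coe_set_eq, Set.ncard_compl, Set.ncard_singleton, hV]
        have hle := (ih (n - 1) (by omega) (by omega) _ hcard (G.induce {v}ᶜ)).1
        have harith := two_mul_gEq_add_fEq_le (by omega) hn hadm'.four_mul_le
        rw [hdel] at hf
        have h1 := Nat.mul_le_mul_left (2 * n) hf
        have h2 := Nat.mul_le_mul_left (2 * n) hle
        rw [mul_add] at h1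
        omega
    refine ⟨?_, ⟨fun heq => ?_, fun hnest => ?_⟩, fun _ => hfilled⟩
    -- More than `g ≥ f` copies would already force a filled balanced blowup, whose count is at most
    -- `g`.
    · by_contra hlt
      obtain ⟨c, hc, hG⟩ := hfilled (by omega)
      apply hlt
      rw [hformula c hc hG, hgsum c hc]
      exact Nat.add_le_add_left (Finset.sum_le_sum fun i _ => (hparts c hc i).1) _
    · obtain ⟨c, hc, hG⟩ := hfilled (by omega)
      refine .nest G (by omega) c hc hG fun i => (hparts c hc i).2.mp ?_
      rw [hformula c hc hG, hgsum c hc] at heq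
      exact (Finset.sum_eq_sum_iff_of_le fun i _ => (hparts c hc i).1).mp
        (Nat.add_left_cancel heq) i (Finset.mem_univ i)
    · cases hnest with
      | small _ hlt => omega
      | nest _ _ c hc hG hp =>
        rw [hformula c hc hG, hgsum c hc]
        congr 1
        exact Finset.sum_congr rfl fun i _ => (hparts c hc i).2.mpr (hp i)

/-! ### Choice of the parameters and conclusion. -/

theorem exists_rpow_le {θ b : ℝ} (hθ : 0 < θ) (hb : 0 < b) (hb1 : b ≤ 1) :
    ∃ x : ℝ, 0 < x ∧ x ≤ 1 ∧ x ^ θ ≤ b := by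
  refine ⟨b ^ θ⁻¹, by positivity, Real.rpow_le_one hb.le hb1 (by positivity), ?_⟩
  rw [← Real.rpow_mul hb.le, inv_mul_cancel₀ hθ.ne', Real.rpow_one]

open Filter in
theorem eventually_rpow_mul_log_le {ε γ : ℝ} (hε : 0 < ε) (hγ : 0 < γ) :
    ∀ᶠ h : ℕ in atTop, (h : ℝ) ^ (1 - ε) * (3 * Real.logb 2 h + 10) ≤ γ * h := by
  have h1 : (fun x : ℝ => 3 * Real.logb 2 x + 10) =o[atTop] fun x : ℝ => x ^ ε := by
    refine Asymptotics.IsLittleO.add ?_ ?_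
    · have : (fun x : ℝ => 3 * Real.logb 2 x) = fun x => (3 / Real.log 2) * Real.log x := by
        funext x
        rw [Real.logb]
        ring
      rw [this]
      exact (isLittleO_log_rpow_atTop hε).const_mul_left _
    · rw [Asymptotics.isLittleO_const_left]
      exact Or.inr (tendsto_norm_atTop_atTop.comp (tendsto_rpow_atTop hε))
  have h2 := tendsto_natCast_atTop_atTop (R := ℝ) |>.eventually (h1.def hγ)
  filter_upwards [h2, eventually_gt_atTop 0] with h hle hpos
  have hpos' : (0 : ℝ) < h := by exact_mod_cast hpos
  rw [Real.norm_eq_abs, Real.norm_eq_abs, abs_of_nonneg (Real.rpow_nonneg hpos'.le _)] at hle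
  calc (h : ℝ) ^ (1 - ε) * (3 * Real.logb 2 h + 10) ≤ (h : ℝ) ^ (1 - ε) * (γ * (h : ℝ) ^ ε) := by
        gcongr
        exact (le_abs_self _).trans hle
    _ = γ * ((h : ℝ) ^ (1 - ε) * (h : ℝ) ^ ε) := by ring
    _ = γ * h := by rw [← Real.rpow_add hpos']; simp

-- The chosen `γ` is an absolute constant; only `h₀` depends on `ε`. The condition on `n ^ (q + 10)`
-- becomes `h ^ (1 - ε) * (3 * log h + 10) ≤ γ * h`, true for large `h` as logarithms grow slower
-- than `h ^ ε`.
open Filter in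
theorem exists_isAdmissible (ε : ℝ) (hε : 0 < ε) :
    ∃ γ : ℝ, ∃ h₀ : ℕ, 1000 ≤ h₀ ∧ ∀ h q : ℕ, h₀ < h → (q : ℝ) ≤ 3 * Real.logb 2 h →
      ∀ n : ℕ, h ≤ n → (n : ℝ) ≤ (2 : ℝ) ^ ((h : ℝ) ^ (1 - ε)) → IsAdmissible h n q γ := by
  obtain ⟨x, hx0, hx1, hx⟩ := exists_rpow_le (θ := 1 / 10 ^ 6) (b := 1 / 64) (by norm_num)
    (by norm_num) (by norm_num)
  obtain ⟨h₁, hh₁⟩ := eventually_atTop.mp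
    (eventually_rpow_mul_log_le hε (show 0 < x / 4 by positivity))
  refine ⟨x / 4, max h₁ 1000, le_max_right _ _, fun h q hh hq n hhn hn => ?_⟩
  have hmax := max_lt_iff.mp hh
  have hx4 : 4 * (x / 4) = x := by ring
  refine ⟨by positivity, by rw [hx4]; exact hx1, by rw [hx4]; linarith, by omega, hhn, ?_⟩
  calc (n : ℝ) ^ (q + 10) ≤ ((2 : ℝ) ^ ((h : ℝ) ^ (1 - ε))) ^ (q + 10) := by gcongr
    _ = (2 : ℝ) ^ ((h : ℝ) ^ (1 - ε) * ((q + 10 : ℕ) : ℝ)) := by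
        rw [Real.rpow_mul (by norm_num), Real.rpow_natCast]
    _ ≤ _ := by
        apply Real.rpow_le_rpow_of_exponent_le (by norm_num)
        refine le_trans ?_ (hh₁ h hmax.1.le)
        push_cast
        gcongr

end SimpleGraph

theorem theorem4p1 (ε : ℝ) (hε : 0 < ε) :
    ∃ h₀ : ℕ, ∀ h : ℕ, h₀ < h → ∀ n : ℕ, (n : ℝ) ≤ (2 : ℝ) ^ ((h : ℝ) ^ (1 - ε)) →
      ∀ H : SimpleGraph (Fin h), H.IsStronglyAsymmetric →
        (H.maxInducedCopies n = gEq n h ∧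
          ∀ G : SimpleGraph (Fin n),
            H.inducedCopies G = H.maxInducedCopies n ↔ H.IsNestedBalancedBlowup G) ∧
        (h ≤ n → ∀ G : SimpleGraph (Fin n),
          fEq n h ≤ H.inducedCopies G → H.IsFilledBalancedBlowup G) := by
  obtain ⟨γ, h₀, hh₀, hadm⟩ := SimpleGraph.exists_isAdmissible ε hε
  refine ⟨h₀, fun h hh n hn H hH => ?_⟩
  obtain ⟨Q, hQ, hQc⟩ := hH.distinguishing
  have hext := hH.extremal (by omega) hQ (N := n)
    (fun m hm hmn => hadm h _ hh hQc m hm (le_trans (by exact_mod_cast hmn) hn)) n le_rfl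
    (Fin n) (by simp)
  have hmax : H.maxInducedCopies n = gEq n h := by
    -- Some nested balanced blowup exists on `Fin n`, so the upper bound `g` is attained.
    obtain ⟨G, hG⟩ := SimpleGraph.exists_isNestedBalancedBlowup (by omega) H n (Fin n) (by simp)
    refine le_antisymm (ciSup_le fun G => (hext G).1) ?_
    rw [← (hext G).2.1.mpr hG]
    exact le_ciSup (f := fun G => H.inducedCopies G) (Set.toFinite _).bddAbove G
  exact ⟨⟨hmax, fun G => by rw [hmax]; exact (hext G).2.1⟩, fun hhn G => (hext G).2.2 hhn⟩
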